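/- **Tribonacci representation.** Let $T_0=0$, $T_1=T_2=1$ and $T_n=T_{n-1}+T_{n-2}+T_{n-3}$ for $n\ge 3$. For a binary word $w=w_1\cdots w_t$ put $[w]_T=\sum_{1\le i\le t} w_i\,T_{t+2-i}$. Every integer $N\ge 0$ has a unique Tribonacci representation $(N)_T$: the binary word $w$ with $[w]_T=N$, with no block $111$ and with no leading zero. A sequence $(y_N)_{N\ge 0}$ of non-negative integers is *Tribonacci-synchronized* if some finite automaton over $\{0,1\}^2$, reading $(N)_T$ and $(x)_T$ in parallel (the shorter one padded with leading zeros), accepts if and only if $x=y_N$; the automaton is then said to *synchronize* the sequence. **The sequences.** For sequences $X,Y$ call $(n,x,y)$ *good* if $x,y$ are positive integers such that $y>x$; neither $x$ nor $y$ lies in $\{X(k):1\le k<n\}\cup\{Y(k):1\le k<n\}$; and $y-x$ lies in neither $\{Y(k)-X(k):1\le k<n\}$ nor $\{Y(k)+X(k):1\le k<n\}$. From now on $X,Y$ are the greedy sequences: $X(0)=Y(0)=0$, $X(1)=1$, $Y(1)=2$, and for $n>1$, $X(n)$ is the least $x$ such that $(n,x,y)$ is good for some $y$, and $Y(n)$ is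 the least $y$ such that $(n,X(n),y)$ is good (OEIS A140100, A140101). **The automata.** Let $\mathtt{xaut}$ (27 states) and $\mathtt{yaut}$ (30 states) be the following automata over $\{0,1\}^2$ with partial transition functions and start state $0$; a run that meets a missing transition (written $-$) rejects. The row of a state $q$ lists its successors under the letters $(0,0),(0,1),(1,0),(1,1)$, in this order. $\mathtt{xaut}$: accepting states $0,2,5,7,10,11,14,15,17,19,23,25$; rows $0$: $0,1,{-},2$; $1$: ${-},{-},3,{-}$; $2$: $4,5,{-},{-}$; $3$: $6,{-},7,8$; $4$: ${-},9,{-},{-}$; $5$: $10,{-},{-},{-}$; $6$: $1,{-},11,12$; $7$: ${-},13,{-},{-}$; $8$: $14,1,{-},{-}$; $9$: ${-},15,{-},{-}$; $10$: $16,1,{-},2$; $11$: $4,17,{-},{-}$; $12$: $18,{-},19,20$; $13$: ${-},21,{-},{-}$; $14$: $10,1,{-},2$; $15$: $4,{-},{-},{-}$; $16$: $14,1,{-},2$; $17$: $10,1,{-},15$; $18$: ${-},{-},16,22$; $19$: ${-},23,{-},{-}$; $20$: $6,{-},{-},{-}$; $21$: $7,{-},{-},{-}$; $22$: ${-},{-},20,{-}$;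 $23$: $24,25,{-},{-}$; $24$: $7,26,{-},{-}$; $25$: $18,{-},19,{-}$; $26$: $14,1,{-},15$. $\mathtt{yaut}$: accepting states $0,3,7,11,15,19,23,27,29$; rows $0$: $0,1,{-},{-}$; $1$: $2,{-},3,4$; $2$: ${-},{-},5,6$; $3$: ${-},7,{-},{-}$; $4$: $8,{-},{-},{-}$; $5$: $9,10,{-},11$; $6$: ${-},{-},12,13$; $7$: ${-},14,{-},{-}$; $8$: $15,1,{-},{-}$; $9$: $2,{-},3,16$; $10$: ${-},{-},17,18$; $11$: ${-},19,{-},{-}$; $12$: $8,1,{-},{-}$; $13$: $2,{-},{-},{-}$; $14$: $3,{-},{-},{-}$; $15$: $12,1,{-},{-}$; $16$: $8,20,{-},{-}$; $17$: $21,22,23,24$; $18$: ${-},{-},25,{-}$; $19$: $26,{-},{-},{-}$; $20$: $2,{-},3,{-}$; $21$: ${-},{-},12,1$; $22$: ${-},{-},18,{-}$; $23$: ${-},{-},{-},{-}$; $24$: $27,28,{-},{-}$; $25$: $9,10,{-},{-}$; $26$: ${-},11,{-},{-}$; $27$: $26,29,{-},{-}$; $28$: $17,{-},{-},{-}$; $29$: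 $12,20,{-},{-}$. Write $\mathtt{xaut}(n,x)$ if $\mathtt{xaut}$ accepts the padded representations of $n$ and $x$ in parallel, and likewise $\mathtt{yaut}(n,y)$. Let $\mathtt{good}(n,x,y)$ be the statement: $y>x$; there is no $k$ with $0\le k<n$ for which one of $\mathtt{xaut}(k,x)$, $\mathtt{xaut}(k,y)$, $\mathtt{yaut}(k,x)$, $\mathtt{yaut}(k,y)$ holds; and there are no $k,a,b\ge 0$ with $k<n$, $\mathtt{xaut}(k,a)$, $\mathtt{yaut}(k,b)$ and $y-x=b-a$ or $y-x=b+a$. **Theorem.** 1. The automaton $\mathtt{xaut}$ synchronizes $X$ and $\mathtt{yaut}$ synchronizes $Y$; in particular $X$ and $Y$ are Tribonacci-synchronized. More precisely, for binary words $w,z$ of equal length, $\mathtt{xaut}$ (respectively $\mathtt{yaut}$) accepts the word with projections $w$ and $z$ if and only if neither $w$ nor $z$ contains $111$ and $[z]_T=X([w]_T)$ (respectively $[z]_T=Y([w]_T)$). 2. For all $n\ge1$: the triple $(n,X(n),Y(n))$ is good; if $(n,x,y)$ is good then $x\ge X(n)$; if $(n,X(n),y)$ is good then $y\ge Y(n)$.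 3. For all $n\ge 1$ and $x,y\ge0$: (check1) $\mathtt{xaut}(n,x)$ and $\mathtt{yaut}(n,y)$ imply $\mathtt{good}(n,x,y)$; (check2) $\mathtt{good}(n,x,y)$ implies that there is $z$ with $\mathtt{xaut}(n,z)$ and $x\ge z$; (check3) $\mathtt{xaut}(n,x)$ and $\mathtt{good}(n,x,y)$ imply that there is $z$ with $\mathtt{yaut}(n,z)$ and $y\ge z$. -/

import Mathlib

namespace TribGame

/-! ### The greedy sequences -/

/-- `(n, x, y)` is good with respect to `X`, `Y`: the positive integers `x < y` are admissible
candidates for the `n`-th terms, given the terms with index `1 ≤ k < n`. -/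
def Good (X Y : ℕ → ℕ) (n x y : ℕ) : Prop :=
  0 < x ∧ x < y ∧
  (∀ k, 1 ≤ k → k < n → x ≠ X k) ∧
  (∀ k, 1 ≤ k → k < n → y ≠ X k) ∧
  (∀ k, 1 ≤ k → k < n → x ≠ Y k) ∧
  (∀ k, 1 ≤ k → k < n → y ≠ Y k) ∧
  (∀ k, 1 ≤ k → k < n → (y : ℤ) - x ≠ (Y k : ℤ) - X k) ∧
  (∀ k, 1 ≤ k → k < n → (y : ℤ) - x ≠ (Y k : ℤ) + X k)

/-- The pairs `(X n, Y n)`: start with `(0, 0)`, `(1, 2)`; afterwards take the least possible first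
entry, and then the least possible second entry. -/
noncomputable def greedyPair : ℕ → ℕ × ℕ
  | 0 => (0, 0)
  | 1 => (1, 2)
  | n + 2 =>
    let prev : ℕ → ℕ × ℕ := fun k => if _h : k < n + 2 then greedyPair k else (0, 0)
    let x := sInf {x | ∃ y, Good (fun k => (prev k).1) (fun k => (prev k).2) (n + 2) x y}
    (x, sInf {y | Good (fun k => (prev k).1) (fun k => (prev k).2) (n + 2) x y})
termination_by n => n

/-- The sequence `X(n)` (A140100). -/
noncomputable def X (n : ℕ) : ℕ := (greedyPair n).1

/-- The sequence `Y(n)` (A140101). -/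
noncomputable def Y (n : ℕ) : ℕ := (greedyPair n).2

theorem good_congr {X Y X' Y' : ℕ → ℕ} {n : ℕ} (hX : ∀ k < n, X k = X' k)
    (hY : ∀ k < n, Y k = Y' k) (x y : ℕ) : Good X Y n x y ↔ Good X' Y' n x y := by
  unfold Good
  refine and_congr Iff.rfl (and_congr Iff.rfl (and_congr ?_ (and_congr ?_ (and_congr ?_
    (and_congr ?_ (and_congr ?_ ?_)))))) <;>
  · refine forall_congr' fun k => forall_congr' fun _ => forall_congr' fun hk => ?_
    simp only [hX k hk, hY k hk]

theorem exists_good (X Y : ℕ → ℕ) (n : ℕ) : ∃ x y, Good X Y n x y := by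
  have h : ∀ k, k < n → X k + Y k ≤ ∑ i ∈ Finset.range n, (X i + Y i) := fun k hk =>
    Finset.single_le_sum (f := fun i => X i + Y i) (fun _ _ => Nat.zero_le _)
      (Finset.mem_range.2 hk)
  generalize ∑ i ∈ Finset.range n, (X i + Y i) = S at h
  refine ⟨S + 1, 2 * S + 3, by omega, by omega, ?_, ?_, ?_, ?_, ?_, ?_⟩ <;>
  · intro k _ hk
    have := h k hk
    omega

theorem X_zero : X 0 = 0 := by simp [X, greedyPair]
theorem Y_zero : Y 0 = 0 := by simp [Y, greedyPair]
theorem X_one : X 1 = 1 := by simp [X, greedyPair]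
theorem Y_one : Y 1 = 2 := by simp [Y, greedyPair]

theorem greedyPair_step (n : ℕ) (hn : 1 < n) :
    X n = sInf {x | ∃ y, Good X Y n x y} ∧ Y n = sInf {y | Good X Y n (X n) y} := by
  obtain ⟨m, rfl⟩ : ∃ m, n = m + 2 := ⟨n - 2, by omega⟩
  have key : ∀ x y, Good
      (fun k => (if _h : k < m + 2 then greedyPair k else ((0, 0) : ℕ × ℕ)).1)
      (fun k => (if _h : k < m + 2 then greedyPair k else ((0, 0) : ℕ × ℕ)).2) (m + 2) x y ↔
      Good X Y (m + 2) x y := fun x y =>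
    good_congr (fun k hk => by simp [hk, X]) (fun k hk => by simp [hk, Y]) x y
  have hX : X (m + 2) = sInf {x | ∃ y, Good X Y (m + 2) x y} := by
    rw [X, greedyPair]; simp only [key]
  refine ⟨hX, ?_⟩
  rw [hX, Y, greedyPair]; simp only [key]

/-- For `n > 1`, `X n` is the least possible first entry of a good triple. -/
theorem X_isLeast (n : ℕ) (hn : 1 < n) : IsLeast {x | ∃ y, Good X Y n x y} (X n) := by
  rw [(greedyPair_step n hn).1]
  exact ⟨Nat.sInf_mem (exists_good X Y n), fun _ h => Nat.sInf_le h⟩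

/-- For `n > 1`, `Y n` is the least possible last entry of a good triple `(n, X n, y)`. -/
theorem Y_isLeast (n : ℕ) (hn : 1 < n) : IsLeast {y | Good X Y n (X n) y} (Y n) := by
  rw [(greedyPair_step n hn).2]
  exact ⟨Nat.sInf_mem (X_isLeast n hn).1, fun _ h => Nat.sInf_le h⟩

/-! ### Tribonacci representations -/

/-- The Tribonacci numbers `0, 1, 1, 2, 4, 7, 13, …`. -/
def T : ℕ → ℕ
  | 0 => 0
  | 1 => 1
  | 2 => 1
  | n + 3 => T (n + 2) + T (n + 1) + T n

/-- `[w]_T = ∑_{1 ≤ i ≤ t} w_i T_{t+2-i}` for a binary word `w = w_1 ⋯ w_t`, so that the last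
letter has weight `T_2 = 1` (the index `i` below starts at `0`). -/
def tribVal (w : List (Fin 2)) : ℕ :=
  ∑ i : Fin w.length, (w.get i : ℕ) * T (w.length + 1 - i)

/-- The word does not contain the block `111`. -/
def NoThreeOnes (w : List (Fin 2)) : Prop := ¬ [1, 1, 1] <:+: w

/-- `w` is the Tribonacci representation of `N`: it has value `N`, avoids `111`, and has no
leading zero. -/
def IsTribRep (N : ℕ) (w : List (Fin 2)) : Prop :=
  tribVal w = N ∧ NoThreeOnes w ∧ w.head? ≠ some 0

theorem T_step (n : ℕ) : T (n + 3) = T (n + 2) + T (n + 1) + T n := rfl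

theorem tribVal_nil : tribVal [] = 0 := by simp [tribVal]

theorem tribVal_cons (d : Fin 2) (w : List (Fin 2)) :
    tribVal (d :: w) = d * T (w.length + 2) + tribVal w := by
  unfold tribVal
  simp only [List.length_cons]
  rw [Fin.sum_univ_succ]
  congr 1
  refine Finset.sum_congr rfl fun i _ => ?_
  simp only [List.get_eq_getElem, Fin.val_succ, List.getElem_cons_succ]
  congr 2
  omega

theorem tribVal_zero_cons (w : List (Fin 2)) : tribVal (0 :: w) = tribVal w := by
  simp [tribVal_cons]

theorem tribVal_one_cons (w : List (Fin 2)) :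
    tribVal (1 :: w) = T (w.length + 2) + tribVal w := by
  simp [tribVal_cons]

theorem noThreeOnes_nil : NoThreeOnes [] := by simp [NoThreeOnes]

theorem noThreeOnes_of_cons {d : Fin 2} {w : List (Fin 2)} (h : NoThreeOnes (d :: w)) :
    NoThreeOnes w := fun h' => h (List.infix_cons_iff.2 (Or.inr h'))

theorem noThreeOnes_zero_cons {w : List (Fin 2)} (h : NoThreeOnes w) : NoThreeOnes (0 :: w) := by
  simpa [NoThreeOnes, List.infix_cons_iff, List.cons_prefix_cons] using h

theorem noThreeOnes_one_zero {w : List (Fin 2)} (h : NoThreeOnes w) :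
    NoThreeOnes (1 :: 0 :: w) := by
  simpa [NoThreeOnes, List.infix_cons_iff, List.cons_prefix_cons] using h

theorem noThreeOnes_one_one_zero {w : List (Fin 2)} (h : NoThreeOnes w) :
    NoThreeOnes (1 :: 1 :: 0 :: w) := by
  simpa [NoThreeOnes, List.infix_cons_iff, List.cons_prefix_cons] using h

theorem eq_zero_or_one (d : Fin 2) : d = 0 ∨ d = 1 := by omega

theorem tribVal_lt : ∀ w : List (Fin 2), NoThreeOnes w → tribVal w < T (w.length + 2)
  | [], _ => by simp [tribVal, T]
  | [d], _ => by
    rcases eq_zero_or_one d with rfl | rfl <;> simp [tribVal_cons, tribVal_nil, T]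
  | [d, e], _ => by
    rcases eq_zero_or_one d with rfl | rfl <;> rcases eq_zero_or_one e with rfl | rfl <;>
      simp [tribVal_cons, tribVal_nil, T]
  | d :: e :: f :: w, h => by
    have h1 := tribVal_lt (e :: f :: w) (noThreeOnes_of_cons h)
    have h2 := tribVal_lt (f :: w) (noThreeOnes_of_cons (noThreeOnes_of_cons h))
    have h3 := tribVal_lt w (noThreeOnes_of_cons (noThreeOnes_of_cons (noThreeOnes_of_cons h)))
    have t1 := T_step (w.length + 2)
    have t2 := T_step (w.length + 1)
    simp only [List.length_cons, tribVal_cons, Nat.add_assoc, Nat.reduceAdd] at h1 h2 h3 t1 t2 ⊢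
    rcases eq_zero_or_one d with rfl | rfl
    · simp only [Fin.val_zero, zero_mul]; omega
    rcases eq_zero_or_one e with rfl | rfl
    · simp only [Fin.val_zero, Fin.val_one, zero_mul, one_mul] at *; omega
    rcases eq_zero_or_one f with rfl | rfl
    · simp only [Fin.val_zero, Fin.val_one, zero_mul, one_mul] at *; omega
    · exact absurd (List.infix_cons_iff.2 (Or.inl (by simp))) h

theorem tribVal_inj_of_length : ∀ u v : List (Fin 2), u.length = v.length → NoThreeOnes u →
    NoThreeOnes v → tribVal u = tribVal v → u = v
  | [], [], _, _, _, _ => rfl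
  | [], _ :: _, h, _, _, _ => by simp at h
  | _ :: _, [], h, _, _, _ => by simp at h
  | d :: u, e :: v, hl, hu, hv, h => by
    have hl' : u.length = v.length := by simpa using hl
    have bu := tribVal_lt u (noThreeOnes_of_cons hu)
    have bv := tribVal_lt v (noThreeOnes_of_cons hv)
    rw [tribVal_cons, tribVal_cons, hl'] at h
    rw [hl'] at bu
    have ih := tribVal_inj_of_length u v hl' (noThreeOnes_of_cons hu) (noThreeOnes_of_cons hv)
    rcases eq_zero_or_one d with rfl | rfl <;> rcases eq_zero_or_one e with rfl | rfl <;>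
      simp at h ⊢
    · exact ih h
    · omega
    · omega
    · exact ih h

theorem T_mono : Monotone T := by
  refine monotone_nat_of_le_succ fun n => ?_
  match n with
  | 0 => simp [T]
  | 1 => simp [T]
  | n + 2 =>
    show T (n + 2) ≤ T (n + 3)
    have := T_step n
    omega

theorem le_tribVal {w : List (Fin 2)} (h : w.head? ≠ some 0) (hw : w ≠ []) :
    T (w.length + 1) ≤ tribVal w := by
  cases w with
  | nil => exact absurd rfl hw
  | cons d w =>
    rcases eq_zero_or_one d with rfl | rfl
    · simp at h
    · rw [tribVal_one_cons]; simp

theorem length_le_of_rep {N : ℕ} {u v : List (Fin 2)} (hu : IsTribRep N u)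
    (hv : IsTribRep N v) : u.length ≤ v.length := by
  by_contra! hlt
  have h1 := le_tribVal hu.2.2 (by rintro rfl; simp at hlt)
  have h2 := tribVal_lt v hv.2.1
  have h3 : T (v.length + 2) ≤ T (u.length + 1) := T_mono (by omega)
  have h4 := hu.1
  have h5 := hv.1
  omega

theorem exists_word : ∀ L N : ℕ, N < T (L + 2) →
    ∃ w : List (Fin 2), w.length = L ∧ NoThreeOnes w ∧ tribVal w = N
  | 0, N, h => ⟨[], rfl, noThreeOnes_nil, by simp [T] at h; simp [tribVal_nil, h]⟩
  | 1, N, h => by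
    have h' : N < 2 := by simpa [T] using h
    refine ⟨[⟨N, h'⟩], rfl, ?_, by simp [tribVal_cons, tribVal_nil, T]⟩
    intro h; simpa using h.length_le
  | 2, N, h => by
    have h' : N < 4 := by simpa [T] using h
    refine ⟨[⟨N / 2, by omega⟩, ⟨N % 2, by omega⟩], rfl, ?_, ?_⟩
    · intro h; simpa using h.length_le
    · simp [tribVal_cons, tribVal_nil, T]; omega
  | L + 3, N, h => by
    have t1 := T_step (L + 2)
    have e1 : L + 3 + 2 = L + 2 + 3 := by omega
    rw [e1] at h
    by_cases h1 : N < T (L + 2 + 2)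
    · obtain ⟨w, hl, hw, hN⟩ := exists_word (L + 2) N h1
      exact ⟨0 :: w, by simpa using hl, noThreeOnes_zero_cons hw, by rw [tribVal_zero_cons, hN]⟩
    by_cases h2 : N < T (L + 4) + T (L + 3)
    · obtain ⟨w, hl, hw, hN⟩ := exists_word (L + 1) (N - T (L + 4)) (by
        show _ < T (L + 3)
        change N < T (L + 5) at h
        change T (L + 5) = T (L + 4) + T (L + 3) + T (L + 2) at t1
        change ¬ N < T (L + 4) at h1
        omega)
      refine ⟨1 :: 0 :: w, by simpa using hl, noThreeOnes_one_zero hw, ?_⟩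
      rw [tribVal_one_cons, tribVal_zero_cons, hN, List.length_cons, hl]
      show T (L + 4) + _ = N
      change ¬ N < T (L + 4) at h1
      omega
    · obtain ⟨w, hl, hw, hN⟩ := exists_word L (N - T (L + 4) - T (L + 3)) (by
        change N < T (L + 5) at h
        change T (L + 5) = T (L + 4) + T (L + 3) + T (L + 2) at t1
        omega)
      refine ⟨1 :: 1 :: 0 :: w, by simpa using hl, noThreeOnes_one_one_zero hw, ?_⟩
      rw [tribVal_one_cons, tribVal_one_cons, tribVal_zero_cons, hN, List.length_cons,
        List.length_cons, hl]
      show T (L + 4) + (T (L + 3) + _) = N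
      omega

theorem tribVal_dropZeros : ∀ w : List (Fin 2), ∃ v, tribVal v = tribVal w ∧
    (NoThreeOnes w → NoThreeOnes v) ∧ v.head? ≠ some 0
  | [] => ⟨[], rfl, id, by simp⟩
  | d :: w => by
    rcases eq_zero_or_one d with rfl | rfl
    · obtain ⟨v, h1, h2, h3⟩ := tribVal_dropZeros w
      exact ⟨v, by rw [h1, tribVal_zero_cons], fun h => h2 (noThreeOnes_of_cons h), h3⟩
    · exact ⟨1 :: w, rfl, id, by simp⟩

/-- Every natural number has exactly one Tribonacci representation. -/
theorem existsUnique_tribRep (N : ℕ) : ∃! w, IsTribRep N w := by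
  have hT : ∀ n, n < T (n + 2) := by
    intro n
    induction n with
    | zero => simp [T]
    | succ n ih =>
      have h1 := T_step n
      have h2 : 0 < T (n + 1) := by
        have := T_mono (show 1 ≤ n + 1 by omega); simp [T] at this; omega
      have e : n + 1 + 2 = n + 3 := rfl
      rw [e]; omega
  obtain ⟨w, -, hw, hN⟩ := exists_word N N (hT N)
  obtain ⟨v, h1, h2, h3⟩ := tribVal_dropZeros w
  refine ⟨v, ⟨h1.trans hN, h2 hw, h3⟩, fun u hu => ?_⟩
  have hv : IsTribRep N v := ⟨h1.trans hN, h2 hw, h3⟩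
  exact tribVal_inj_of_length u v (le_antisymm (length_le_of_rep hu hv) (length_le_of_rep hv hu))
    hu.2.1 hv.2.1 (hu.1.trans hv.1.symm)

/-- The Tribonacci representation `(N)_T`, most significant digit first. -/
noncomputable def tribRep (N : ℕ) : List (Fin 2) := (existsUnique_tribRep N).choose

theorem tribRep_spec (N : ℕ) : IsTribRep N (tribRep N) := (existsUnique_tribRep N).choose_spec.1

/-- The Tribonacci representations of `N` and `x` in parallel, the shorter one padded with
leading zeros. -/
noncomputable def parallelRep (N x : ℕ) : List (Fin 2 × Fin 2) :=
  let L := max (tribRep N).length (tribRep x).length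
  ((tribRep N).leftpad L 0).zip ((tribRep x).leftpad L 0)

/-! ### Automata -/

/-- On input `N` and `x` in parallel, the automaton `M` accepts iff `x = y N`. -/
def Synchronizes {σ : Type*} (M : DFA (Fin 2 × Fin 2) σ) (y : ℕ → ℕ) : Prop :=
  ∀ N x, parallelRep N x ∈ M.accepts ↔ x = y N

/-- The sequence `y` is Tribonacci-synchronized. -/
def IsTribSynchronized (y : ℕ → ℕ) : Prop :=
  ∃ (m : ℕ) (M : DFA (Fin 2 × Fin 2) (Fin m)), Synchronizes M y

/-- A deterministic automaton whose transition function may be partial. -/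
structure PartialDFA (α σ : Type*) where
  step : σ → α → Option σ
  start : σ
  accept : Set σ

/-- The completion of a partial automaton by a rejecting sink `none`: a run that meets a missing
transition rejects. -/
def PartialDFA.toDFA {α σ : Type*} (M : PartialDFA α σ) : DFA α (Option σ) where
  step q a := q.bind fun s => M.step s a
  start := some M.start
  accept := some '' M.accept

/-- Transitions of `xaut`: the entry in row `q` at position `a`, `b` is the successor of the state
`q` under the letter `(a, b)`. -/
def xTable : Fin 27 → Fin 2 → Fin 2 → Option (Fin 27) :=
  ![![![some 0, some 1], ![none, some 2]],
    ![![none, none], ![some 3, none]],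
    ![![some 4, some 5], ![none, none]],
    ![![some 6, none], ![some 7, some 8]],
    ![![none, some 9], ![none, none]],
    ![![some 10, none], ![none, none]],
    ![![some 1, none], ![some 11, some 12]],
    ![![none, some 13], ![none, none]],
    ![![some 14, some 1], ![none, none]],
    ![![none, some 15], ![none, none]],
    ![![some 16, some 1], ![none, some 2]],
    ![![some 4, some 17], ![none, none]],
    ![![some 18, none], ![some 19, some 20]],
    ![![none, some 21], ![none, none]],
    ![![some 10, some 1], ![none, some 2]],
    ![![some 4, none], ![none, none]],
    ![![some 14, some 1], ![none, some 2]],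
    ![![some 10, some 1], ![none, some 15]],
    ![![none, none], ![some 16, some 22]],
    ![![none, some 23], ![none, none]],
    ![![some 6, none], ![none, none]],
    ![![some 7, none], ![none, none]],
    ![![none, none], ![some 20, none]],
    ![![some 24, some 25], ![none, none]],
    ![![some 7, some 26], ![none, none]],
    ![![some 18, none], ![some 19, none]],
    ![![some 14, some 1], ![none, some 15]]]

/-- Transitions of `yaut`, in the same format. -/
def yTable : Fin 30 → Fin 2 → Fin 2 → Option (Fin 30) :=
  ![![![some 0, some 1], ![none, none]],
    ![![some 2, none], ![some 3, some 4]],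
    ![![none, none], ![some 5, some 6]],
    ![![none, some 7], ![none, none]],
    ![![some 8, none], ![none, none]],
    ![![some 9, some 10], ![none, some 11]],
    ![![none, none], ![some 12, some 13]],
    ![![none, some 14], ![none, none]],
    ![![some 15, some 1], ![none, none]],
    ![![some 2, none], ![some 3, some 16]],
    ![![none, none], ![some 17, some 18]],
    ![![none, some 19], ![none, none]],
    ![![some 8, some 1], ![none, none]],
    ![![some 2, none], ![none, none]],
    ![![some 3, none], ![none, none]],
    ![![some 12, some 1], ![none, none]],
    ![![some 8, some 20], ![none, none]],
    ![![some 21, some 22], ![some 23, some 24]],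
    ![![none, none], ![some 25, none]],
    ![![some 26, none], ![none, none]],
    ![![some 2, none], ![some 3, none]],
    ![![none, none], ![some 12, some 1]],
    ![![none, none], ![some 18, none]],
    ![![none, none], ![none, none]],
    ![![some 27, some 28], ![none, none]],
    ![![some 9, some 10], ![none, none]],
    ![![none, some 11], ![none, none]],
    ![![some 26, some 29], ![none, none]],
    ![![some 17, none], ![none, none]],
    ![![some 12, some 20], ![none, none]]]

/-- The automaton `xaut` with 27 states. -/
def xaut : PartialDFA (Fin 2 × Fin 2) (Fin 27) where
  step q a := xTable q a.1 a.2
  start := 0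
  accept := {0, 2, 5, 7, 10, 11, 14, 15, 17, 19, 23, 25}

/-- The automaton `yaut` with 30 states. -/
def yaut : PartialDFA (Fin 2 × Fin 2) (Fin 30) where
  step q a := yTable q a.1 a.2
  start := 0
  accept := {0, 3, 7, 11, 15, 19, 23, 27, 29}

/-- The binary relation on natural numbers computed by an automaton. -/
def PartialDFA.Rel {σ : Type*} (M : PartialDFA (Fin 2 × Fin 2) σ) (n x : ℕ) : Prop :=
  parallelRep n x ∈ M.toDFA.accepts

/-- The predicate `good` as expressed through the two automata (here `k` ranges over all natural
numbers below `n`, including `0`). -/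
def GoodAut (n x y : ℕ) : Prop :=
  y > x ∧
  (¬ ∃ k, k < n ∧ xaut.Rel k x) ∧
  (¬ ∃ k, k < n ∧ xaut.Rel k y) ∧
  (¬ ∃ k, k < n ∧ yaut.Rel k x) ∧
  (¬ ∃ k, k < n ∧ yaut.Rel k y) ∧
  (¬ ∃ k a b, k < n ∧ xaut.Rel k a ∧ yaut.Rel k b ∧ (y : ℤ) - x = (b : ℤ) - a) ∧
  (¬ ∃ k a b, k < n ∧ xaut.Rel k a ∧ yaut.Rel k b ∧ (y : ℤ) - x = (b : ℤ) + a)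

end TribGame

namespace TribGame

/-! ### Appending digits -/

/-! Write s(n) for the number represented by (n)_T followed by a zero (`shift`), and c(n) for the
state that records how (n)_T ends (`cls`). The sequences have closed forms X(n) = s(s(n)) - s(n) +
`xOff` and Y(n) = n + s(n) + `yOff`, with bounded corrections depending on c(n) only. It remains to
see that these formulas give the greedy sequences, and that the automata compute them.

Greediness. Put D = Y - X. If X and D increase strictly, X is complementary to Y, and D is
complementary to X + Y, then any candidate x below X(n), and any difference y - X(n) below D(n), is
already used; this determines the greedy sequences (`IsGreedySystem.X_Y_eq`). Monotonicity holds
because the increments of s and s∘s at n depend on c(n) only (`succ_spec`). Complementarity follows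
from explicit indices, obtained by appending digits to n or to n - 1, at which X jumps over Y(n) and
D jumps over X(n) + Y(n) (`xNat_yVal`, `dNat_sum`, `complementary_of_count`).

Automata. Up to the correction, the output is a linear map of the values of w, w0, w00, and this map
commutes with appending a zero. Hence the deviation of the second track from it can be updated
letter by letter, and it stays in a finite list along all surviving runs: this gives soundness. For
completeness, a subset construction on the first track shows that every admissible input has some
accepted output; soundness and uniqueness of representations identify that output
(`PartialDFA.mem_accepts_iff`). Since the automata then define the graphs of X and Y, the three
checks restate the greedy properties. -/

theorem tribVal_append (w u : List (Fin 2)) :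
    tribVal (w ++ u) = tribVal (w ++ List.replicate u.length 0) + tribVal u := by
  induction w with
  | nil =>
    have : ∀ k, tribVal (List.replicate k 0) = 0 := by
      intro k
      induction k with
      | zero => simp [tribVal_nil]
      | succ k ih => rw [List.replicate_succ, tribVal_zero_cons, ih]
    simp [this]
  | cons d w ih =>
    simp only [List.cons_append, tribVal_cons, List.length_append, List.length_replicate, ih]
    ring

/-- The Tribonacci recurrence applied to each digit; it makes the triple of values of w, w0, w00
closed under appending digits. -/
theorem tribVal_append_three_zeros (w : List (Fin 2)) :
    tribVal (w ++ [0, 0, 0]) = tribVal w + tribVal (w ++ [0]) + tribVal (w ++ [0, 0]) := by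
  induction w with
  | nil => simp [tribVal_cons, tribVal_nil]
  | cons d w ih =>
    have := T_step (w.length + 2)
    simp only [List.cons_append, tribVal_cons, List.length_append, ih, List.length_cons,
      List.length_nil, Nat.add_assoc, Nat.reduceAdd] at this ⊢
    rw [this]
    ring

/-- The effect of appending the digit `a` to a word on the triple of values of the word with no,
one and two zeros appended. -/
def pushDigit (v : ℤ × ℤ × ℤ) (a : Fin 2) : ℤ × ℤ × ℤ :=
  (v.2.1 + (a : ℕ), v.2.2 + 2 * (a : ℕ), v.1 + v.2.1 + v.2.2 + 4 * (a : ℕ))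

/-- The values of `w`, `w0` and `w00`, computed from left to right. -/
def valVec (w : List (Fin 2)) : ℤ × ℤ × ℤ := w.foldl pushDigit (0, 0, 0)

theorem valVec_concat (w : List (Fin 2)) (a : Fin 2) :
    valVec (w ++ [a]) = pushDigit (valVec w) a := by simp [valVec]

theorem valVec_zero_cons (w : List (Fin 2)) : valVec (0 :: w) = valVec w := by
  simp [valVec, pushDigit]

theorem valVec_eq (w : List (Fin 2)) : valVec w =
    ((tribVal w : ℤ), (tribVal (w ++ [0]) : ℤ), (tribVal (w ++ [0, 0]) : ℤ)) := by
  induction w using List.reverseRecOn with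
  | nil => simp [valVec, tribVal_cons, tribVal_nil]
  | append_singleton w a ih =>
    -- The constants 1, 2, 4 in `pushDigit` are the weights T_2, T_3, T_4.
    have h1 : tribVal [a] = a := by simp [tribVal_cons, tribVal_nil, T]
    have h2 : tribVal [a, 0] = 2 * a := by simp [tribVal_cons, tribVal_nil, T]; ring
    have h3 : tribVal [a, 0, 0] = 4 * a := by simp [tribVal_cons, tribVal_nil, T]; ring
    have e1 := tribVal_append w [a]
    have e2 := tribVal_append w [a, 0]
    have e3 := tribVal_append w [a, 0, 0]
    simp only [List.length_cons, List.length_nil, List.replicate_succ, List.replicate_zero,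
      zero_add, Nat.reduceAdd] at e1 e2 e3
    rw [valVec_concat, ih, List.append_assoc, List.append_assoc, List.cons_append, List.nil_append,
      List.cons_append, List.nil_append, e1, e2, e3, h1, h2, h3, tribVal_append_three_zeros]
    simp [pushDigit]

/-! ### The suffix automaton -/

/-- A six-state automaton that rejects the words with a block `111` and otherwise computes the
length of the final block of zeros modulo `3` (state `0` stands for words without digit `1`). -/
def suffixStep : Fin 6 → Fin 2 → Option (Fin 6) :=
  ![![some 0, some 1], ![some 2, some 3], ![some 4, some 1], ![some 2, none],
    ![some 5, some 1], ![some 2, some 1]]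

/-- The state of the suffix automaton after reading `w`. -/
def suffixRun (w : List (Fin 2)) : Option (Fin 6) :=
  w.foldl (fun q a => q.bind fun s => suffixStep s a) (some 0)

theorem suffixRun_concat (w : List (Fin 2)) (a : Fin 2) :
    suffixRun (w ++ [a]) = (suffixRun w).bind fun s => suffixStep s a := by simp [suffixRun]

theorem suffixRun_zero_cons (w : List (Fin 2)) : suffixRun (0 :: w) = suffixRun w := by
  simp [suffixRun, suffixStep]

theorem append_singleton_suffix_iff {α : Type*} (u w : List α) (a b : α) :
    u ++ [b] <:+ w ++ [a] ↔ b = a ∧ u <:+ w := by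
  rw [List.suffix_concat_iff]
  constructor
  · rintro (h | ⟨t, ht, hs⟩)
    · simp at h
    · obtain ⟨rfl, h⟩ := List.append_inj' ht rfl
      exact ⟨by simpa using h, hs⟩
  · rintro ⟨rfl, h⟩
    exact Or.inr ⟨u, rfl, h⟩

theorem noThreeOnes_concat_zero (w : List (Fin 2)) : NoThreeOnes (w ++ [0]) ↔ NoThreeOnes w := by
  have : [1, 1, 1] <:+ w ++ [0] ↔ 1 = (0 : Fin 2) ∧ [1, 1] <:+ w :=
    append_singleton_suffix_iff [1, 1] w 0 1
  rw [NoThreeOnes, NoThreeOnes, List.infix_concat_iff, this]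
  simp

theorem noThreeOnes_concat_one (w : List (Fin 2)) :
    NoThreeOnes (w ++ [1]) ↔ NoThreeOnes w ∧ ¬ [1, 1] <:+ w := by
  have : [1, 1, 1] <:+ w ++ [1] ↔ [1, 1] <:+ w :=
    (append_singleton_suffix_iff [1, 1] w 1 1).trans (by simp)
  rw [NoThreeOnes, NoThreeOnes, List.infix_concat_iff, this]
  tauto

/-- Rejection happens only on reading 1 after 11, so the induction must also carry which states mean
that the word ends in 1 or in 11. -/
theorem suffixRun_spec (w : List (Fin 2)) : (NoThreeOnes w ↔ (suffixRun w).isSome) ∧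
    ∀ q, suffixRun w = some q → ([1] <:+ w ↔ q = 1 ∨ q = 3) ∧ ([1, 1] <:+ w ↔ q = 3) := by
  induction w using List.reverseRecOn with
  | nil => simp [suffixRun, noThreeOnes_nil]
  | append_singleton w a ih =>
    obtain ⟨ih1, ih2⟩ := ih
    rw [suffixRun_concat]
    have e1 : [1, 1] <:+ w ++ [1] ↔ [1] <:+ w :=
      (append_singleton_suffix_iff [1] w 1 1).trans (by simp)
    have e2 : [1] <:+ w ++ [(1 : Fin 2)] := List.suffix_append _ _
    have e3 : ¬ [1] <:+ w ++ [(0 : Fin 2)] := fun h => by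
      simpa using ((append_singleton_suffix_iff [] w 0 1).1 h).1
    have e4 : ¬ [1, 1] <:+ w ++ [(0 : Fin 2)] := fun h => by
      simpa using ((append_singleton_suffix_iff [1] w 0 1).1 h).1
    cases hq : suffixRun w with
    | none =>
      rw [hq] at ih1
      rcases eq_zero_or_one a with rfl | rfl <;>
        simp [noThreeOnes_concat_zero, noThreeOnes_concat_one, ih1]
    | some q =>
      obtain ⟨h1, h2⟩ := ih2 q hq
      rw [hq] at ih1
      rcases eq_zero_or_one a with rfl | rfl
      · simp only [noThreeOnes_concat_zero, ih1, e3, e4]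
        fin_cases q <;> simp [suffixStep]
      · simp only [noThreeOnes_concat_one, ih1, e1, e2, h1, h2]
        fin_cases q <;> simp [suffixStep]

theorem noThreeOnes_iff (w : List (Fin 2)) : NoThreeOnes w ↔ ∃ q, suffixRun w = some q := by
  rw [(suffixRun_spec w).1, Option.isSome_iff_exists]

/-! ### Dependence on the value only -/

theorem replicate_zero_append_invariant {α : Type*} (f : List (Fin 2) → α)
    (hf : ∀ w, f (0 :: w) = f w) (k : ℕ) (w : List (Fin 2)) :
    f (List.replicate k 0 ++ w) = f w := by
  induction k with
  | zero => rfl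
  | succ k ih => rw [List.replicate_succ, List.cons_append, hf, ih]

theorem noThreeOnes_replicate_append (k : ℕ) (w : List (Fin 2)) :
    NoThreeOnes (List.replicate k 0 ++ w) ↔ NoThreeOnes w := by
  rw [noThreeOnes_iff, noThreeOnes_iff,
    replicate_zero_append_invariant suffixRun suffixRun_zero_cons]

theorem tribVal_replicate_append (k : ℕ) (w : List (Fin 2)) :
    tribVal (List.replicate k 0 ++ w) = tribVal w :=
  replicate_zero_append_invariant tribVal tribVal_zero_cons k w

/-- Padding with zeros to a common length makes the two words equal. Functions blind to leading
zeros thus descend to functions of the number, which is how `shift` and `cls` are evaluated on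
padded words. -/
theorem eq_of_tribVal_eq {α : Type*} (f : List (Fin 2) → α) (hf : ∀ w, f (0 :: w) = f w)
    {u v : List (Fin 2)} (hu : NoThreeOnes u) (hv : NoThreeOnes v) (h : tribVal u = tribVal v) :
    f u = f v := by
  rw [← replicate_zero_append_invariant f hf v.length u,
    ← replicate_zero_append_invariant f hf u.length v]
  congr 1
  exact tribVal_inj_of_length _ _ (by simp [add_comm])
    ((noThreeOnes_replicate_append _ _).2 hu) ((noThreeOnes_replicate_append _ _).2 hv)
    (by simp only [tribVal_replicate_append, h])

/-- The value of `(n)_T` followed by a zero. -/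
noncomputable def shift (n : ℕ) : ℕ := tribVal (tribRep n ++ [0])

/-- The state of the suffix automaton after reading `(n)_T`. -/
noncomputable def cls (n : ℕ) : Fin 6 := (suffixRun (tribRep n)).getD 0

theorem shift_tribVal {w : List (Fin 2)} (h : NoThreeOnes w) :
    shift (tribVal w) = tribVal (w ++ [0]) :=
  eq_of_tribVal_eq (fun w => tribVal (w ++ [0])) (fun w => by simp [tribVal_zero_cons])
    (tribRep_spec _).2.1 h (tribRep_spec _).1

theorem suffixRun_eq_cls {w : List (Fin 2)} (h : NoThreeOnes w) :
    suffixRun w = some (cls (tribVal w)) := by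
  obtain ⟨q, hq⟩ := (noThreeOnes_iff w).1 h
  have := eq_of_tribVal_eq suffixRun suffixRun_zero_cons (tribRep_spec _).2.1 h
    (tribRep_spec (tribVal w)).1
  -- The default value in `cls` is never used, since a representation avoids 111.
  rw [cls, this, hq]; rfl

theorem valVec_of_noThreeOnes {w : List (Fin 2)} (h : NoThreeOnes w) :
    valVec w = ((tribVal w : ℤ), (shift (tribVal w) : ℤ), (shift (shift (tribVal w)) : ℤ)) := by
  rw [shift_tribVal h, shift_tribVal ((noThreeOnes_concat_zero w).2 h), valVec_eq]
  simp

theorem shift_zero : shift 0 = 0 := by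
  simpa [tribVal_cons, tribVal_nil] using shift_tribVal noThreeOnes_nil

theorem cls_zero : cls 0 = 0 := by
  have := suffixRun_eq_cls noThreeOnes_nil
  rw [tribVal_nil] at this
  exact (Option.some.inj this).symm

/-- Passing from `n` to the number represented by `(n)_T` followed by the digit `a`. -/
theorem append_digit {n : ℕ} {a : Fin 2} {q : Fin 6} (h : suffixStep (cls n) a = some q) :
    cls (shift n + a) = q ∧ shift (shift n + a) = shift (shift n) + 2 * a ∧
      shift (shift (shift n + a)) = n + shift n + shift (shift n) + 4 * a := by
  have hn := (tribRep_spec n).2.1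
  have hv := (tribRep_spec n).1
  have hr := suffixRun_eq_cls hn
  rw [hv] at hr
  have hr' : suffixRun (tribRep n ++ [a]) = some q := by
    rw [suffixRun_concat, hr, Option.bind_some, h]
  have hw : NoThreeOnes (tribRep n ++ [a]) := (noThreeOnes_iff _).2 ⟨q, hr'⟩
  have h1 := valVec_of_noThreeOnes hw
  rw [valVec_concat, valVec_of_noThreeOnes hn, hv] at h1
  simp only [pushDigit, Prod.mk.injEq] at h1
  have e : tribVal (tribRep n ++ [a]) = shift n + a := by have := h1.1; omega
  rw [e] at h1
  have h2 := suffixRun_eq_cls hw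
  rw [e, hr'] at h2
  exact ⟨(Option.some.inj h2).symm, by omega, by omega⟩

/-- Every number arises by appending a digit to the representation of another number. -/
theorem exists_append_digit (m : ℕ) : ∃ n a q, suffixStep (cls n) a = some q ∧
    m = shift n + (a : Fin 2) := by
  obtain ⟨w, hw, hm⟩ : ∃ w, NoThreeOnes w ∧ tribVal w = m :=
    ⟨_, (tribRep_spec m).2.1, (tribRep_spec m).1⟩
  rcases List.eq_nil_or_concat w with rfl | ⟨u, a, rfl⟩
  -- The empty word has no last digit; 0 counts as 0 followed by the digit 0.
  · refine ⟨0, 0, 0, by rw [cls_zero]; rfl, ?_⟩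
    rw [← hm, tribVal_nil, shift_zero]; rfl
  · obtain ⟨q, hq⟩ := (noThreeOnes_iff _).1 hw
    rw [List.concat_eq_append] at hw hm hq
    rw [suffixRun_concat] at hq
    obtain ⟨p, hp, hpq⟩ := Option.bind_eq_some_iff.1 hq
    have hu : NoThreeOnes u := (noThreeOnes_iff _).2 ⟨p, hp⟩
    have hc := suffixRun_eq_cls hu
    rw [hp] at hc
    refine ⟨tribVal u, a, q, by rw [← Option.some.inj hc, hpq], ?_⟩
    have h1 := valVec_concat u a
    rw [valVec_of_noThreeOnes hu, valVec_of_noThreeOnes hw] at h1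
    simp only [pushDigit, Prod.mk.injEq] at h1
    have := h1.1
    omega

/-! ### Complementary sequences determine the greedy sequences -/

/-- The positive values of `a` and of `b` partition the positive integers. -/
def Complementary (a b : ℕ → ℕ) : Prop :=
  (∀ m, ∃ k, m = a k ∨ m = b k) ∧ ∀ j k, 1 ≤ k → a j ≠ b k

/-- The hypotheses say that `a` passes from b(n) - 1 to b(n) + 1 between the consecutive indices
b(n) - n and b(n) - n + 1, so it misses b(n). Counting shows that nothing else is missed. -/
theorem complementary_of_count {a b : ℕ → ℕ} (ha : StrictMono a) (hb : StrictMono b)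
    (ha0 : a 0 = 0) (hb0 : b 0 = 0) (ha1 : a 1 = 1)
    (hpred : ∀ n, 1 ≤ n → a (b n - n) + 1 = b n)
    (hsucc : ∀ n, 1 ≤ n → a (b n - n + 1) = b n + 1) : Complementary a b := by
  refine ⟨fun m => ?_, fun j k hk h => ?_⟩
  · have hgap : ∀ i r, a i + r ≤ a (i + r) := by
      intro i r
      induction r with
      | zero => simp
      | succ r ih => have := ha (show i + r < i + (r + 1) by omega); omega
    -- Here j and k count the terms of positive index of `a` and `b` that are at most m; j + k = m
    -- says that every number up to m is hit once.
    suffices h : ∃ j k, j + k = m ∧ a j ≤ m ∧ m < a (j + 1) ∧ b k ≤ m ∧ m < b (k + 1) ∧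
        (m = a j ∨ m = b k) by
      obtain ⟨j, k, -, -, -, -, -, h | h⟩ := h
      exacts [⟨j, Or.inl h⟩, ⟨k, Or.inr h⟩]
    induction m with
    | zero =>
      have := hb (show 0 < 0 + 1 by omega)
      exact ⟨0, 0, rfl, by omega, by simp [ha1], by omega, by omega, Or.inl ha0.symm⟩
    | succ m ih =>
      obtain ⟨j, k, hjk, h1, h2, h3, h4, -⟩ := ih
      have h5 := hpred (k + 1) (by omega)
      have h6 := hsucc (k + 1) (by omega)
      have h7 := hb (show k + 1 < k + 1 + 1 by omega)
      by_cases hm : b (k + 1) = m + 1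
      · have e : b (k + 1) - (k + 1) = j := by omega
        rw [e] at h5 h6
        exact ⟨j, k + 1, by omega, by omega, by omega, by omega, by omega, Or.inr hm.symm⟩
      -- From a(b(k+1) - (k+1)) = b(k+1) - 1 and growth by at least 1 per step, descending to index
      -- j + 1 gives a(j+1) ≤ m + 1, hence equality.
      · have h8 := hgap (j + 1) (b (k + 1) - (k + 1) - (j + 1))
        have e : j + 1 + (b (k + 1) - (k + 1) - (j + 1)) = b (k + 1) - (k + 1) := by omega
        rw [e] at h8
        have h9 := ha (show j + 1 < j + 1 + 1 by omega)
        exact ⟨j + 1, k, by omega, by omega, by omega, by omega, by omega, Or.inl (by omega)⟩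
  · have h1 := hpred k hk
    have h2 := hsucc k hk
    rcases Nat.lt_or_ge (b k - k) j with hj | hj
    · have := ha.monotone (show b k - k + 1 ≤ j by omega); omega
    · have := ha.monotone hj; omega

/-- Strictly increasing sequences `x`, `d` such that `x` is complementary to `x + d` and `d` is
complementary to `2x + d`. -/
structure IsGreedySystem (x d : ℕ → ℕ) : Prop where
  x_zero : x 0 = 0
  d_zero : d 0 = 0
  x_strictMono : StrictMono x
  d_strictMono : StrictMono d
  x_compl : Complementary x (fun n => x n + d n)
  d_compl : Complementary d (fun n => x n + d n + x n)

namespace IsGreedySystem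

variable {x d : ℕ → ℕ}

theorem good (h : IsGreedySystem x d) {n : ℕ} (hn : 1 ≤ n) :
    Good x (fun n => x n + d n) n (x n) (x n + d n) := by
  have hx0 := h.x_strictMono (show 0 < n from hn)
  have hd0 := h.d_strictMono (show 0 < n from hn)
  refine ⟨by omega, by omega, ?_, ?_, ?_, ?_, ?_, ?_⟩ <;> intro k hk hkn
  · exact (h.x_strictMono hkn).ne'
  · have := h.x_strictMono hkn; omega
  · exact h.x_compl.2 n k hk
  · have := h.x_strictMono hkn; have := h.d_strictMono hkn; simp only; omega
  · have := h.d_strictMono hkn; push_cast; omega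
  · have := h.d_compl.2 n k hk; simp only at this; push_cast; omega

/-- By complementarity a positive candidate is x(k) or x(k) + d(k) for some k ≥ 1. Goodness excludes
k < n, and k ≥ n makes it at least x(n). -/
theorem le_left (h : IsGreedySystem x d) {n a b : ℕ}
    (hg : Good x (fun n => x n + d n) n a b) : x n ≤ a := by
  obtain ⟨h1, -, h3, -, h5, -⟩ := hg
  obtain ⟨k, hk⟩ := h.x_compl.1 a
  have hx0 := h.x_zero
  have hd0 := h.d_zero
  have hk0 : 1 ≤ k := by
    rcases Nat.eq_zero_or_pos k with rfl | hk0
    · simp only at hk; omega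
    · exact hk0
  rcases Nat.lt_or_ge k n with hkn | hkn
  · rcases hk with hk | hk
    exacts [absurd hk (h3 k hk0 hkn), absurd hk (h5 k hk0 hkn)]
  · have := h.x_strictMono.monotone hkn; simp only at hk; omega

/-- The same argument for the difference b - x(n), using the complementarity of `d` and 2x + d. -/
theorem le_right (h : IsGreedySystem x d) {n b : ℕ}
    (hg : Good x (fun n => x n + d n) n (x n) b) : x n + d n ≤ b := by
  obtain ⟨-, h2, -, -, -, -, h7, h8⟩ := hg
  obtain ⟨k, hk⟩ := h.d_compl.1 (b - x n)
  have hx0 := h.x_zero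
  have hd0 := h.d_zero
  have hk0 : 1 ≤ k := by
    rcases Nat.eq_zero_or_pos k with rfl | hk0
    · simp only at hk; omega
    · exact hk0
  rcases Nat.lt_or_ge k n with hkn | hkn
  · have h7 := h7 k hk0 hkn
    have h8 := h8 k hk0 hkn
    simp only at hk
    push_cast at h7 h8
    omega
  · have := h.d_strictMono.monotone hkn; simp only at hk; omega

theorem X_Y_eq (h : IsGreedySystem x d) (h1 : x 1 = 1) (h2 : d 1 = 1) (n : ℕ) :
    X n = x n ∧ Y n = x n + d n := by
  induction n using Nat.strong_induction_on with
  | _ n ih =>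
    rcases Nat.lt_or_ge 1 n with hn | hn
    · have hc := good_congr (n := n) (fun k hk => (ih k hk).1) (fun k hk => (ih k hk).2)
      have hX := X_isLeast n hn
      have hX' : IsLeast {a | ∃ b, Good X Y n a b} (x n) :=
        ⟨⟨_, (hc _ _).2 (h.good hn.le)⟩, fun a ⟨b, hb⟩ => h.le_left ((hc _ _).1 hb)⟩
      have e := hX.unique hX'
      have hY := Y_isLeast n hn
      rw [e] at hY
      have hY' : IsLeast {b | Good X Y n (x n) b} (x n + d n) :=
        ⟨(hc _ _).2 (h.good hn.le), fun b hb => h.le_right ((hc _ _).1 hb)⟩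
      exact ⟨e, hY.unique hY'⟩
    · obtain rfl | rfl : n = 0 ∨ n = 1 := by omega
      · simp [X_zero, Y_zero, h.x_zero, h.d_zero]
      · simp [X_one, Y_one, h1, h2]

end IsGreedySystem

/-! ### Consecutive numbers -/

theorem tribVal_le_append_zero (w : List (Fin 2)) : tribVal w ≤ tribVal (w ++ [0]) ∧
    (0 < tribVal w → tribVal w < tribVal (w ++ [0])) := by
  induction w with
  | nil => simp [tribVal_nil, tribVal_cons]
  | cons d w ih =>
    have h1 : T (w.length + 3) = _ := T_step w.length
    have h2 : 1 ≤ T (w.length + 1) := T_mono (show 1 ≤ w.length + 1 by omega)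
    rcases eq_zero_or_one d with rfl | rfl
    · simpa [tribVal_zero_cons] using ih
    · simp only [List.cons_append, tribVal_one_cons, List.length_append, List.length_cons,
        List.length_nil, Nat.add_assoc, Nat.reduceAdd] at h1 ⊢
      omega

theorem le_shift (n : ℕ) : n ≤ shift n ∧ (0 < n → n < shift n) := by
  have := tribVal_le_append_zero (tribRep n)
  rwa [(tribRep_spec n).1] at this

/-- The possible states of the suffix automaton at consecutive numbers. -/
def adjacentStates : List (Fin 6 × Fin 6) :=
  [(0, 1), (1, 2), (2, 1), (2, 3), (2, 5), (3, 4), (4, 1), (5, 1)]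

/-- The increment `shift (n + 1) - shift n` as a function of `cls n`. -/
def shiftInc : Fin 6 → ℕ := ![2, 2, 2, 1, 2, 2]

/-- The increment of `shift (shift n)` as a function of `cls n`. -/
def shiftTwiceInc : Fin 6 → ℕ := ![4, 3, 4, 2, 4, 4]

/-- Siblings: both digits can be appended to the same number, and the results are consecutive. -/
theorem adjacent_children : ∀ p q r, suffixStep p 0 = some q → suffixStep p 1 = some r →
    (q, r) ∈ adjacentStates ∧ shiftInc q = 2 ∧ shiftTwiceInc q = 4 := by decide

-- Cousins: if a is the last digit that k admits, the successor of s(k) + a is s(k+1). The data of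
-- this new pair are determined by those of the pair k, k + 1.
set_option synthInstance.maxHeartbeats 200000 in
set_option synthInstance.maxSize 1000 in
theorem adjacent_cousins : ∀ p q, (p, q) ∈ adjacentStates → ∀ a p' q',
    suffixStep p a = some p' → (a : ℕ) + 1 = shiftInc p → suffixStep q 0 = some q' →
    (p', q') ∈ adjacentStates ∧ shiftInc p' + 2 * a = shiftTwiceInc p ∧
      shiftTwiceInc p' + 4 * a = 1 + shiftInc p + shiftTwiceInc p := by decide

theorem exists_suffixStep_zero : ∀ q, ∃ q', suffixStep q 0 = some q' := by decide

theorem suffixStep_one : ∀ q, (∃ q', suffixStep q 1 = some q') ∨ shiftInc q = 1 ∧ q ≠ 0 := by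
  decide

theorem append_zero {n : ℕ} {q : Fin 6} (h : suffixStep (cls n) 0 = some q) :
    cls (shift n) = q ∧ shift (shift (shift n)) = n + shift n + shift (shift n) := by
  obtain ⟨h1, -, h3⟩ := append_digit h
  exact ⟨h1, h3⟩

theorem append_one {n : ℕ} {q : Fin 6} (h : suffixStep (cls n) 1 = some q) :
    cls (shift n + 1) = q ∧ shift (shift n + 1) = shift (shift n) + 2 ∧
      shift (shift (shift n + 1)) = n + shift n + shift (shift n) + 4 := append_digit h

/-- Strong induction along the tree whose edges append a digit: n and n + 1 are either siblings,
where no induction hypothesis is needed, or cousins, where the hypothesis for the parent of n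
applies. -/
theorem succ_spec (n : ℕ) : (cls n, cls (n + 1)) ∈ adjacentStates ∧
    shift (n + 1) = shift n + shiftInc (cls n) ∧
    shift (shift (n + 1)) = shift (shift n) + shiftTwiceInc (cls n) := by
  induction n using Nat.strong_induction_on with
  | _ m ih =>
    obtain ⟨k, a, q, hq, hm⟩ := exists_append_digit m
    obtain ⟨f1, f2, f3⟩ := append_digit hq
    rw [← hm] at f1 f2 f3
    have cousins : (a : ℕ) + 1 = shiftInc (cls k) → k < m →
        (cls m, cls (m + 1)) ∈ adjacentStates ∧
        shift (m + 1) = shift m + shiftInc (cls m) ∧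
        shift (shift (m + 1)) = shift (shift m) + shiftTwiceInc (cls m) := by
      intro hinc hk
      obtain ⟨g1, g2, g3⟩ := ih k hk
      obtain ⟨q', hq'⟩ := exists_suffixStep_zero (cls (k + 1))
      obtain ⟨t1, t3⟩ := append_zero hq'
      obtain ⟨c1, c2, c3⟩ := adjacent_cousins _ _ g1 a q q' hq hinc hq'
      have e : m + 1 = shift (k + 1) := by omega
      rw [e, f1, f3, f2, t1, t3]
      exact ⟨c1, by omega, by omega⟩
    rcases eq_zero_or_one a with rfl | rfl
    · rcases suffixStep_one (cls k) with ⟨r, hr⟩ | ⟨hinc, h0⟩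
      · obtain ⟨t1, t2, t3⟩ := append_one hr
        obtain ⟨c1, c2, c3⟩ := adjacent_children _ _ _ hq hr
        have e : m = shift k := hm
        simp only [Fin.val_zero, mul_zero, add_zero] at f2 f3
        rw [f1, f3, f2, e, t1, t3, t2]
        exact ⟨c1, by omega, by omega⟩
      -- With digit 0 the parent is smaller than m only if it is nonzero, which its state
      -- guarantees.
      · refine cousins (by simp [hinc]) ?_
        have : 0 < k := by
          rcases Nat.eq_zero_or_pos k with rfl | hk
          · exact absurd cls_zero h0
          · exact hk
        have := (le_shift k).2 this
        omega
    · have h1 := (le_shift k).1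
      have h2 : ∀ q q', suffixStep q 1 = some q' → ((1 : Fin 2) : ℕ) + 1 = shiftInc q := by decide
      rw [Fin.val_one] at hm
      exact cousins (h2 _ _ hq) (by omega)

/-! ### Explicit formulas -/

/-- The part of `X n` that depends on `cls n` only. -/
def xOff : Fin 6 → ℤ := ![0, -1, 0, -1, 0, -1]

/-- The part of `Y n` that depends on `cls n` only. -/
def yOff : Fin 6 → ℤ := ![0, -1, -1, -1, 0, -1]

/-- The explicit form of the sequence `X`. -/
noncomputable def xVal (n : ℕ) : ℤ := shift (shift n) - shift n + xOff (cls n)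

/-- The explicit form of the sequence `Y`. -/
noncomputable def yVal (n : ℕ) : ℤ := n + shift n + yOff (cls n)

/-- The increment of `X` as a function of `cls n`. -/
def xInc : Fin 6 → ℕ := ![1, 2, 1, 2, 1, 2]

/-- The increment of `Y - X` as a function of `cls n`. -/
def dInc : Fin 6 → ℕ := ![1, 1, 2, 1, 1, 1]

theorem inc_eq : ∀ p q, (p, q) ∈ adjacentStates →
    (shiftTwiceInc p : ℤ) - shiftInc p + xOff q = xOff p + xInc p ∧
    1 + (shiftInc p : ℤ) + yOff q = yOff p + xInc p + dInc p := by
  decide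

theorem xVal_succ (n : ℕ) : xVal (n + 1) = xVal n + xInc (cls n) := by
  obtain ⟨h1, h2, h3⟩ := succ_spec n
  have := (inc_eq _ _ h1).1
  rw [xVal, xVal, h3, h2]
  push_cast
  linarith

theorem yVal_succ (n : ℕ) : yVal (n + 1) = yVal n + xInc (cls n) + dInc (cls n) := by
  obtain ⟨h1, h2, h3⟩ := succ_spec n
  have := (inc_eq _ _ h1).2
  simp only [yVal, h2]
  push_cast
  linarith

/-! ### Monotonicity and complementarity of the explicit sequences -/

theorem xVal_zero : xVal 0 = 0 := by simp [xVal, shift_zero, cls_zero, xOff]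

theorem yVal_zero : yVal 0 = 0 := by simp [yVal, shift_zero, cls_zero, yOff]

/-- `xVal` with natural values. -/
noncomputable def xNat (n : ℕ) : ℕ := ∑ i ∈ Finset.range n, xInc (cls i)

/-- `yVal - xVal` with natural values. -/
noncomputable def dNat (n : ℕ) : ℕ := ∑ i ∈ Finset.range n, dInc (cls i)

theorem xNat_eq (n : ℕ) : (xNat n : ℤ) = xVal n := by
  induction n with
  | zero => simp [xNat, xVal_zero]
  | succ n ih => rw [xVal_succ, ← ih, xNat, Finset.sum_range_succ, ← xNat]; push_cast; rfl

theorem dNat_eq (n : ℕ) : (dNat n : ℤ) = yVal n - xVal n := by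
  induction n with
  | zero => simp [dNat, xVal_zero, yVal_zero]
  | succ n ih =>
    rw [xVal_succ, yVal_succ, dNat, Finset.sum_range_succ, ← dNat]; push_cast; rw [ih]; ring

theorem inc_pos : ∀ q, 1 ≤ xInc q ∧ 1 ≤ dInc q := by decide

theorem xNat_strictMono : StrictMono xNat := strictMono_nat_of_lt_succ fun n => by
  have := (inc_pos (cls n)).1
  rw [xNat, xNat, Finset.sum_range_succ]; omega

theorem dNat_strictMono : StrictMono dNat := strictMono_nat_of_lt_succ fun n => by
  have := (inc_pos (cls n)).2
  rw [dNat, dNat, Finset.sum_range_succ]; omega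

/-- The index m = Y(n) - n is n followed by 0 when `yOff` vanishes, and n - 1 followed by 1
otherwise. In both cases X increases by 2 there and so skips Y(n). -/
theorem xNat_yVal {n : ℕ} (hn : 1 ≤ n) :
    ∃ m : ℕ, (m : ℤ) = yVal n - n ∧ xVal m = yVal n - 1 ∧ xInc (cls m) = 2 := by
  obtain ⟨k, rfl⟩ : ∃ k, n = k + 1 := ⟨n - 1, by omega⟩
  obtain ⟨h1, h2, h3⟩ := succ_spec k
  have key : ∀ p q, (p, q) ∈ adjacentStates →
      (yOff q = 0 ∧ ∃ q', suffixStep q 0 = some q' ∧ xOff q' = -1 ∧ xInc q' = 2) ∨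
      (yOff q = -1 ∧ shiftInc p = 2 ∧ ∃ q', suffixStep p 1 = some q' ∧ xOff q' = -1 ∧
        xInc q' = 2) := by decide
  rcases key _ _ h1 with ⟨e1, q', e2, e3, e4⟩ | ⟨e1, e0, q', e2, e3, e4⟩
  · obtain ⟨f1, f3⟩ := append_zero e2
    refine ⟨shift (k + 1), ?_, ?_, by rw [f1, e4]⟩
    · rw [yVal, e1]; ring
    · rw [yVal, xVal, e1, f1, e3, f3]; push_cast; ring
  · obtain ⟨f1, f2, f3⟩ := append_one e2
    refine ⟨shift k + 1, ?_, ?_, by rw [f1, e4]⟩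
    · rw [yVal, e1, h2, e0]; push_cast; ring
    · rw [yVal, xVal, e1, f1, e3, f3, f2, h2, e0]; push_cast; ring

/-- The index m = X(n) + Y(n) - n is n followed by 00, or n - 1 followed by 10. Either way m has
state 2, the only one at which D increases by 2. -/
theorem dNat_sum {n : ℕ} (hn : 1 ≤ n) :
    ∃ m : ℕ, (m : ℤ) = xVal n + yVal n - n ∧ yVal m - xVal m = xVal n + yVal n - 1 ∧
      dInc (cls m) = 2 := by
  obtain ⟨k, rfl⟩ : ∃ k, n = k + 1 := ⟨n - 1, by omega⟩
  obtain ⟨h1, h2, h3⟩ := succ_spec k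
  have key : ∀ p q, (p, q) ∈ adjacentStates →
      (xOff q + yOff q = 0 ∧ ∃ r, suffixStep q 0 = some r ∧ suffixStep r 0 = some 2) ∨
      (xOff q + yOff q + shiftTwiceInc p = 2 ∧ ∃ r, suffixStep p 1 = some r ∧
        suffixStep r 0 = some 2) := by decide
  have h4 : yOff 2 = -1 := rfl
  have h5 : xOff 2 = 0 := rfl
  rcases key _ _ h1 with ⟨e1, q', e2, e3⟩ | ⟨e1, q', e2, e3⟩
  · obtain ⟨f1, f3⟩ := append_zero e2
    rw [← f1] at e3
    obtain ⟨g1, g3⟩ := append_zero e3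
    refine ⟨shift (shift (k + 1)), ?_, ?_, by rw [g1]; rfl⟩
    · rw [yVal, xVal]; linarith
    · simp only [yVal, xVal, g1, h4, h5]; omega
  · obtain ⟨f1, f2, f3⟩ := append_one e2
    rw [← f1] at e3
    obtain ⟨g1, g3⟩ := append_zero e3
    refine ⟨shift (shift k + 1), ?_, ?_, by rw [g1]; rfl⟩
    · rw [yVal, xVal]; omega
    · rw [yVal, xVal, yVal, xVal, g1, h4, h5]; omega

theorem isGreedySystem : IsGreedySystem xNat dNat := by
  have hx0 : xNat 0 = 0 := rfl
  have hd0 : dNat 0 = 0 := rfl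
  have hx1 : xNat 1 = 1 := by simp [xNat, cls_zero, xInc]
  have hd1 : dNat 1 = 1 := by simp [dNat, cls_zero, dInc]
  have hx := xNat_strictMono
  have hd := dNat_strictMono
  refine ⟨hx0, hd0, hx, hd, ?_, ?_⟩
  · have key : ∀ n, 1 ≤ n → xNat (xNat n + dNat n - n) + 1 = xNat n + dNat n ∧
        xNat (xNat n + dNat n - n + 1) = xNat n + dNat n + 1 := by
      intro n hn
      obtain ⟨m, h1, h2, h3⟩ := xNat_yVal hn
      have e1 := xNat_eq n
      have e2 := dNat_eq n
      have e3 := xNat_eq m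
      have e4 := xNat_eq (m + 1)
      rw [xVal_succ, h3] at e4
      obtain rfl : m = xNat n + dNat n - n := by omega
      omega
    exact complementary_of_count hx (hx.add hd) hx0 (by simp [hx0, hd0]) hx1
      (fun n hn => (key n hn).1) (fun n hn => (key n hn).2)
  · have key : ∀ n, 1 ≤ n → dNat (xNat n + dNat n + xNat n - n) + 1 = xNat n + dNat n + xNat n ∧
        dNat (xNat n + dNat n + xNat n - n + 1) = xNat n + dNat n + xNat n + 1 := by
      intro n hn
      obtain ⟨m, h1, h2, h3⟩ := dNat_sum hn
      have e1 := xNat_eq n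
      have e2 := dNat_eq n
      have e3 := dNat_eq m
      have e4 := dNat_eq (m + 1)
      rw [xVal_succ, yVal_succ, h3] at e4
      obtain rfl : m = xNat n + dNat n + xNat n - n := by omega
      omega
    exact complementary_of_count hd ((hx.add hd).add hx) hd0 (by simp [hx0, hd0]) hd1
      (fun n hn => (key n hn).1) (fun n hn => (key n hn).2)

theorem X_eq (n : ℕ) : (X n : ℤ) = xVal n := by
  rw [(isGreedySystem.X_Y_eq (by simp [xNat, cls_zero, xInc]) (by simp [dNat, cls_zero, dInc]) n).1,
    xNat_eq]

theorem Y_eq (n : ℕ) : (Y n : ℤ) = yVal n := by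
  rw [(isGreedySystem.X_Y_eq (by simp [xNat, cls_zero, xInc]) (by simp [dNat, cls_zero, dInc]) n).2]
  push_cast
  rw [xNat_eq, dNat_eq]
  ring

/-! ### Certifying an automaton -/

/-- A configuration after reading a word over pairs: the state of the automaton, the states of the
suffix automaton on both tracks, and the deviation of the second track from a linear function of
the first one. -/
abbrev Config (m : ℕ) := Fin m × Fin 6 × Fin 6 × (ℤ × ℤ × ℤ)

namespace PartialDFA

variable {m : ℕ} (M : PartialDFA (Fin 2 × Fin 2) (Fin m)) (lin : ℤ × ℤ × ℤ → ℤ × ℤ × ℤ)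

/-- The configuration after reading one more letter. -/
def stepConfig (c : Config m) (l : Fin 2 × Fin 2) : Option (Config m) :=
  (M.step c.1 l).bind fun s => (suffixStep c.2.1 l.1).bind fun p =>
    (suffixStep c.2.2.1 l.2).bind fun r =>
      some (s, p, r, pushDigit c.2.2.2 l.2 - lin (pushDigit (0, 0, 0) l.1))

/-- The list `L` contains the initial configuration and is closed under reading a letter. -/
def IsInvariant (L : List (Config m)) : Prop :=
  (M.start, 0, 0, (0, 0, 0)) ∈ L ∧ ∀ c ∈ L, ∀ a b, (M.step c.1 (a, b)).isSome →
    ∃ c' ∈ L, M.stepConfig lin c (a, b) = some c'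

/-- For every pair in `L`, consisting of a state of the suffix automaton and a list of states of
`M`, and every admissible digit on the first track, `L` has a pair whose states are all reached
from that list under this digit. -/
def IsSubsetInvariant (L : List (Fin 6 × List (Fin m))) : Prop :=
  ∀ c ∈ L, ∀ a p, suffixStep c.1 a = some p →
    ∃ c' ∈ L, c'.1 = p ∧ ∀ s' ∈ c'.2, ∃ s ∈ c.2, ∃ b, M.step s (a, b) = some s'

set_option synthInstance.maxHeartbeats 200000 in
set_option synthInstance.maxSize 1000 in
instance (L : List (Config m)) : Decidable (M.IsInvariant lin L) := by
  unfold IsInvariant; infer_instance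

set_option synthInstance.maxHeartbeats 200000 in
set_option synthInstance.maxSize 1000 in
instance (L : List (Fin 6 × List (Fin m))) : Decidable (M.IsSubsetInvariant L) := by
  unfold IsSubsetInvariant; infer_instance

variable {M lin}

/-! ### Soundness and completeness from finite checks -/

theorem eval_concat (w : List (Fin 2 × Fin 2)) (l : Fin 2 × Fin 2) :
    M.toDFA.eval (w ++ [l]) = (M.toDFA.eval w).bind fun s => M.step s l := by
  rw [DFA.eval_append_singleton]; rfl

/-- By `hlin`, the new deviation depends only on the old one and on the letter read, so closure of
the finite list controls every surviving run. Closure also requires both suffix automata to survive,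
which excludes 111 on both tracks. -/
theorem IsInvariant.config_mem {L : List (Config m)} (hL : M.IsInvariant lin L)
    (hlin0 : lin (0, 0, 0) = (0, 0, 0))
    (hlin : ∀ v z a b, pushDigit z b - lin (pushDigit v a) =
      pushDigit (z - lin v) b - lin (pushDigit (0, 0, 0) a))
    (w : List (Fin 2 × Fin 2)) (s : Fin m) (h : M.toDFA.eval w = some s) :
    ∃ p r, suffixRun (w.map Prod.fst) = some p ∧ suffixRun (w.map Prod.snd) = some r ∧
      (s, p, r, valVec (w.map Prod.snd) - lin (valVec (w.map Prod.fst))) ∈ L := by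
  induction w using List.reverseRecOn generalizing s with
  | nil =>
    obtain rfl : M.start = s := Option.some.inj h
    refine ⟨0, 0, rfl, rfl, ?_⟩
    change (M.start, 0, 0, (0, 0, 0) - lin (0, 0, 0)) ∈ L
    rw [hlin0]
    exact hL.1
  | append_singleton w l ih =>
    rw [eval_concat] at h
    obtain ⟨s₀, hs₀, hs⟩ := Option.bind_eq_some_iff.1 h
    obtain ⟨p, r, hp, hr, hmem⟩ := ih s₀ hs₀
    obtain ⟨c', hc', hstep⟩ := hL.2 _ hmem l.1 l.2 (by simp [hs])
    simp only [stepConfig, hs, Option.bind_some, Option.bind_eq_some_iff] at hstep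
    obtain ⟨p', hp', r', hr', hc⟩ := hstep
    rw [← Option.some.inj hc] at hc'
    refine ⟨p', r', ?_, ?_, ?_⟩
    · rw [List.map_append, List.map_singleton, suffixRun_concat, hp, Option.bind_some, hp']
    · rw [List.map_append, List.map_singleton, suffixRun_concat, hr, Option.bind_some, hr']
    · rw [List.map_append, List.map_singleton, List.map_append, List.map_singleton,
        valVec_concat, valVec_concat, hlin]
      exact hc'

/-- The second track is guessed: each listed state has a listed predecessor for some second digit.
The k leading zeros leave room for an output longer than the input. -/
theorem IsSubsetInvariant.exists_run {L : List (Fin 6 × List (Fin m))}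
    (hL : M.IsSubsetInvariant L) {S₀ : List (Fin m)} (h0 : (0, S₀) ∈ L)
    (hS₀ : ∀ s ∈ S₀, ∃ v k, v.map Prod.fst = List.replicate k 0 ∧ M.toDFA.eval v = some s)
    (w : List (Fin 2)) (p : Fin 6) (hp : suffixRun w = some p) :
    ∃ S, (p, S) ∈ L ∧ ∀ s ∈ S, ∃ v k, v.map Prod.fst = List.replicate k 0 ++ w ∧
      M.toDFA.eval v = some s := by
  induction w using List.reverseRecOn generalizing p with
  | nil =>
    obtain rfl : 0 = p := Option.some.inj hp
    exact ⟨S₀, h0, by simpa using hS₀⟩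
  | append_singleton w a ih =>
    rw [suffixRun_concat] at hp
    obtain ⟨p₀, hp₀, hpp⟩ := Option.bind_eq_some_iff.1 hp
    obtain ⟨S, hS, hrun⟩ := ih p₀ hp₀
    obtain ⟨⟨p', S'⟩, hS', rfl, hstep⟩ := hL _ hS a p hpp
    refine ⟨S', hS', fun s' hs' => ?_⟩
    obtain ⟨s, hs, b, hb⟩ := hstep s' hs'
    obtain ⟨v, k, hv, he⟩ := hrun s hs
    exact ⟨v ++ [(a, b)], k, by simp [hv], by rw [eval_concat, he, Option.bind_some, hb]⟩

theorem eval_replicate_append (hloop : M.step M.start (0, 0) = some M.start) (k : ℕ)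
    (w : List (Fin 2 × Fin 2)) :
    M.toDFA.eval (List.replicate k (0, 0) ++ w) = M.toDFA.eval w := by
  induction k with
  | zero => rfl
  | succ k ih =>
    rw [← ih, List.replicate_succ, List.cons_append]
    change M.toDFA.evalFrom (M.step M.start (0, 0)) _ = _
    rw [hloop]
    rfl

/-- If the listed finite checks succeed, then the automaton accepts exactly the graph of
`n ↦ lin (n) + c (n)`, where `c` is a function of the state of the suffix automaton. -/
theorem mem_accepts_iff {L : List (Config m)} (hL : M.IsInvariant lin L)
    (hlin0 : lin (0, 0, 0) = (0, 0, 0))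
    (hlin : ∀ v z a b, pushDigit z b - lin (pushDigit v a) =
      pushDigit (z - lin v) b - lin (pushDigit (0, 0, 0) a))
    {c : Fin 6 → ℤ} {acc : List (Fin m)} (hacc : ∀ s, s ∈ M.accept ↔ s ∈ acc)
    (hLc : ∀ x ∈ L, x.1 ∈ acc → x.2.2.2.1 = c x.2.1)
    {K : List (Fin 6 × List (Fin m))} (hK : M.IsSubsetInvariant K) {S₀ : List (Fin m)}
    (h0 : (0, S₀) ∈ K)
    (hS₀ : ∀ s ∈ S₀, ∃ v k, v.map Prod.fst = List.replicate k 0 ∧ M.toDFA.eval v = some s)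
    (hKacc : ∀ x ∈ K, ∃ s ∈ x.2, s ∈ acc) (hloop : M.step M.start (0, 0) = some M.start)
    (w : List (Fin 2 × Fin 2)) :
    w ∈ M.toDFA.accepts ↔ NoThreeOnes (w.map Prod.fst) ∧ NoThreeOnes (w.map Prod.snd) ∧
      (tribVal (w.map Prod.snd) : ℤ) =
        (lin (valVec (w.map Prod.fst))).1 + c (cls (tribVal (w.map Prod.fst))) := by
  have hmem : ∀ w, w ∈ M.toDFA.accepts ↔ ∃ s ∈ acc, M.toDFA.eval w = some s := fun w => by
    rw [DFA.mem_accepts]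
    change _ ∈ some '' M.accept ↔ _
    simp [hacc, eq_comm]
  have hsound : ∀ w : List (Fin 2 × Fin 2), w ∈ M.toDFA.accepts → NoThreeOnes (w.map Prod.fst) ∧
      NoThreeOnes (w.map Prod.snd) ∧ (tribVal (w.map Prod.snd) : ℤ) =
        (lin (valVec (w.map Prod.fst))).1 + c (cls (tribVal (w.map Prod.fst))) := by
    intro w hw
    obtain ⟨s, hs, he⟩ := (hmem w).1 hw
    obtain ⟨p, r, hp, hr, hc⟩ := hL.config_mem hlin0 hlin w s he
    have hfst := (noThreeOnes_iff _).2 ⟨p, hp⟩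
    have h1 := hLc _ hc hs
    rw [suffixRun_eq_cls hfst] at hp
    rw [← Option.some.inj hp, valVec_eq (w.map Prod.snd)] at h1
    simp only [Prod.fst_sub] at h1
    exact ⟨hfst, (noThreeOnes_iff _).2 ⟨r, hr⟩, by linarith⟩
  refine ⟨hsound w, fun ⟨h1, h2, h3⟩ => ?_⟩
  obtain ⟨p, hp⟩ := (noThreeOnes_iff _).1 h1
  obtain ⟨S, hS, hrun⟩ := hK.exists_run h0 hS₀ _ p hp
  obtain ⟨s, hs, hsacc⟩ := hKacc _ hS
  obtain ⟨v, k, hv, he⟩ := hrun s hs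
  -- Soundness for the run found shows that its second track has the same value as that of `w`; by
  -- uniqueness the two words differ only by leading (0, 0) letters, which loop at the start state.
  obtain ⟨-, g2, g3⟩ := hsound v ((hmem v).2 ⟨s, hsacc, he⟩)
  rw [hv, replicate_zero_append_invariant valVec valVec_zero_cons, tribVal_replicate_append,
    ← h3] at g3
  have hlen : v.length = k + w.length := by simpa using congrArg List.length hv
  have hsnd : v.map Prod.snd = List.replicate k 0 ++ w.map Prod.snd :=
    tribVal_inj_of_length _ _ (by simp [hlen]) g2 ((noThreeOnes_replicate_append _ _).2 h2)
      (by rw [tribVal_replicate_append]; exact_mod_cast g3)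
  have hvw : v = List.replicate k (0, 0) ++ w := by
    rw [List.zip_of_prod hv hsnd, List.zip_append (by simp), List.zip_replicate, min_self,
      ← List.zip_of_prod rfl rfl]
  rw [hvw, eval_replicate_append hloop] at he
  exact (hmem w).2 ⟨s, hsacc, he⟩

end PartialDFA

/-! ### The two automata -/

/-- The linear part of `X` on triples of values. -/
def xLin (v : ℤ × ℤ × ℤ) : ℤ × ℤ × ℤ := (v.2.2 - v.2.1, v.1 + v.2.1, v.2.1 + v.2.2)

/-- The linear part of `Y` on triples of values. -/
def yLin (v : ℤ × ℤ × ℤ) : ℤ × ℤ × ℤ :=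
  (v.1 + v.2.1, v.2.1 + v.2.2, v.1 + v.2.1 + 2 * v.2.2)

/-- The accepting states of `xaut`. -/
def xAccept : List (Fin 27) := [0, 2, 5, 7, 10, 11, 14, 15, 17, 19, 23, 25]

/-- The accepting states of `yaut`. -/
def yAccept : List (Fin 30) := [0, 3, 7, 11, 15, 19, 23, 27, 29]

/-- The reachable configurations of `xaut`. -/
def xConfigs : List (Config 27) :=
  [(0, 0, 0, 0, 0, 0), (1, 0, 1, 1, 2, 4), (2, 1, 1, -1, -1, -2), (3, 1, 2, 0, 1, 1),
    (4, 2, 2, -1, -2, -4), (5, 2, 3, 0, 0, 0), (6, 2, 4, 1, 1, 2), (7, 3, 4, -1, -2, -4),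
    (8, 3, 1, 0, 0, 0), (9, 4, 1, -1, -2, -3), (10, 4, 2, 0, 0, 0), (1, 4, 5, 1, 2, 4),
    (11, 1, 5, -1, -1, -2), (12, 1, 1, 0, 1, 2), (13, 2, 1, -1, -2, -3), (14, 2, 2, 0, 0, 0),
    (1, 2, 3, 1, 2, 4), (15, 5, 3, -1, -1, -2), (16, 5, 4, 0, 0, 0), (1, 5, 1, 1, 2, 4),
    (17, 2, 1, 0, 0, 0), (18, 2, 2, 1, 2, 3), (19, 3, 2, -1, -1, -3), (20, 3, 3, 0, 1, 1),
    (21, 4, 3, -1, -1, -2), (10, 4, 4, 0, 0, 0), (1, 4, 1, 1, 2, 4), (14, 2, 5, 0, 0, 0),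
    (1, 2, 1, 1, 2, 4), (1, 4, 3, 1, 2, 4), (15, 1, 3, -1, -1, -2), (16, 1, 4, 0, 0, 0),
    (22, 1, 1, 1, 2, 4), (23, 2, 1, 0, -1, -1), (6, 2, 2, 1, 1, 2), (7, 5, 2, -1, -2, -4),
    (16, 5, 5, 0, 0, 0), (2, 3, 1, -1, -1, -2), (20, 3, 2, 0, 1, 1), (24, 4, 2, -1, -1, -2),
    (25, 4, 3, 0, 1, 2), (1, 4, 4, 1, 2, 4), (11, 1, 4, -1, -1, -2), (7, 5, 4, -1, -2, -4),
    (26, 5, 1, 0, 0, 0), (18, 5, 2, 1, 2, 3), (19, 1, 2, -1, -1, -3), (3, 1, 5, 0, 1, 1),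
    (4, 2, 5, -1, -2, -4), (7, 3, 2, -1, -2, -4)]

/-- The sets of states of `xaut` reachable from `[0, 1]` by digits on the first track. -/
def xStates : List (Fin 6 × List (Fin 27)) :=
  [(0, [0, 1]), (1, [2, 3]), (2, [4, 5, 6]), (3, [7, 8]), (4, [1, 9, 10]), (1, [11, 12]),
    (2, [1, 13, 14]), (5, [1, 15, 16]), (2, [4, 17, 18]), (3, [19, 20]), (4, [1, 10, 21]),
    (2, [1, 4, 14]), (1, [15, 16, 22]), (2, [6, 23]), (5, [1, 7, 16]), (3, [2, 20]),
    (4, [1, 24, 25]), (5, [7, 18, 26]), (1, [3, 19])]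

/-- The reachable configurations of `yaut`. -/
def yConfigs : List (Config 30) :=
  [(0, 0, 0, 0, 0, 0), (1, 0, 1, 1, 2, 4), (2, 0, 2, 2, 4, 7), (3, 1, 2, -1, -2, -4),
    (4, 1, 3, 0, 0, 0), (5, 1, 4, 1, 1, 2), (6, 1, 1, 2, 3, 6), (7, 2, 1, -1, -2, -3),
    (8, 2, 2, 0, 0, 0), (9, 2, 5, 1, 2, 4), (10, 2, 1, 2, 4, 8), (11, 3, 1, -1, -2, -3),
    (12, 3, 2, 0, 0, 0), (13, 3, 3, 1, 2, 4), (14, 4, 3, -1, -1, -2), (15, 4, 4, 0, 0, 0),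
    (1, 4, 1, 1, 2, 4), (2, 4, 2, 2, 4, 7), (16, 1, 1, 0, 0, 0), (17, 1, 2, 1, 2, 3),
    (18, 1, 3, 2, 4, 7), (19, 2, 3, -1, -1, -2), (8, 2, 4, 0, 0, 0), (1, 2, 1, 1, 2, 4),
    (2, 2, 2, 2, 4, 7), (3, 5, 2, -1, -2, -4), (12, 5, 5, 0, 0, 0), (1, 5, 1, 1, 2, 4),
    (2, 5, 2, 2, 4, 7), (20, 2, 3, 1, 2, 4), (21, 2, 4, 2, 3, 6), (22, 2, 1, 3, 5, 10),
    (23, 3, 4, -1, -3, -5), (24, 3, 1, 0, -1, -1), (25, 3, 2, 1, 1, 2), (26, 4, 2, -1, -2, -4),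
    (15, 4, 5, 0, 0, 0), (12, 1, 5, 0, 0, 0), (1, 1, 1, 1, 2, 4), (18, 1, 2, 2, 4, 7),
    (27, 2, 2, -1, -1, -2), (28, 2, 3, 0, 1, 2), (9, 2, 4, 1, 2, 4), (11, 5, 1, -1, -2, -3),
    (12, 5, 2, 0, 0, 0), (3, 3, 2, -1, -2, -4), (4, 3, 3, 0, 0, 0), (25, 3, 4, 1, 1, 2),
    (26, 4, 4, -1, -2, -4), (29, 4, 1, 0, 0, 0), (17, 4, 2, 1, 2, 3), (2, 4, 5, 2, 4, 7),
    (3, 1, 5, -1, -2, -4), (20, 5, 3, 1, 2, 4), (21, 5, 4, 2, 3, 6), (22, 5, 1, 3, 5, 10),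
    (23, 1, 4, -1, -3, -5), (24, 1, 1, 0, -1, -1), (5, 1, 2, 1, 1, 2)]

/-- The sets of states of `yaut` reachable from `[0, 1, 2]` by digits on the first track. -/
def yStates : List (Fin 6 × List (Fin 30)) :=
  [(0, [0, 1, 2]), (1, [3, 4, 5, 6]), (2, [7, 8, 9, 10]), (3, [11, 12, 13]), (4, [1, 2, 14, 15]),
    (1, [3, 16, 17, 18]), (2, [1, 2, 8, 19]), (5, [1, 2, 3, 12]), (2, [7, 8, 20, 21, 22]),
    (3, [23, 24, 25]), (4, [1, 2, 15, 26]), (2, [1, 2, 7, 8]), (1, [1, 3, 12, 18]),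
    (2, [9, 10, 27, 28]), (5, [1, 2, 11, 12]), (3, [3, 4, 25]), (4, [2, 17, 26, 29]),
    (5, [11, 12, 20, 21, 22]), (1, [5, 6, 23, 24])]

theorem xaut_checks : xaut.IsInvariant xLin xConfigs ∧
    (∀ x ∈ xConfigs, x.1 ∈ xAccept → x.2.2.2.1 = xOff x.2.1) ∧
    xaut.IsSubsetInvariant xStates ∧
    (0, [0, 1]) ∈ xStates ∧
    ∀ x ∈ xStates, ∃ s ∈ x.2, s ∈ xAccept := by
  decide +kernel

theorem yaut_checks : yaut.IsInvariant yLin yConfigs ∧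
    (∀ x ∈ yConfigs, x.1 ∈ yAccept → x.2.2.2.1 = yOff x.2.1) ∧
    yaut.IsSubsetInvariant yStates ∧
    (0, [0, 1, 2]) ∈ yStates ∧
    ∀ x ∈ yStates, ∃ s ∈ x.2, s ∈ yAccept := by
  decide +kernel

theorem mem_xaut_accepts (w : List (Fin 2 × Fin 2)) : w ∈ xaut.toDFA.accepts ↔
    NoThreeOnes (w.map Prod.fst) ∧ NoThreeOnes (w.map Prod.snd) ∧
      tribVal (w.map Prod.snd) = X (tribVal (w.map Prod.fst)) := by
  obtain ⟨h1, h2, h3, h4, h5⟩ := xaut_checks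
  rw [PartialDFA.mem_accepts_iff h1 rfl ?_ ?_ h2 h3 h4 ?_ h5 rfl]
  · refine and_congr_right fun h => and_congr_right fun _ => ?_
    rw [← Nat.cast_inj (R := ℤ), X_eq, valVec_of_noThreeOnes h]
    rfl
  · intro v z a b
    simp only [pushDigit, xLin, Prod.mk_sub_mk, Prod.fst_sub, Prod.snd_sub, Prod.mk.injEq]
    refine ⟨by ring, by ring, by ring⟩
  · intro s
    simp [xaut, xAccept]
  · intro s hs
    simp only [List.mem_cons, List.not_mem_nil, or_false] at hs
    rcases hs with rfl | rfl
    -- State 1 covers an output one digit longer than the input.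
    exacts [⟨[], 0, rfl, rfl⟩, ⟨[(0, 1)], 1, rfl, rfl⟩]

theorem mem_yaut_accepts (w : List (Fin 2 × Fin 2)) : w ∈ yaut.toDFA.accepts ↔
    NoThreeOnes (w.map Prod.fst) ∧ NoThreeOnes (w.map Prod.snd) ∧
      tribVal (w.map Prod.snd) = Y (tribVal (w.map Prod.fst)) := by
  obtain ⟨h1, h2, h3, h4, h5⟩ := yaut_checks
  rw [PartialDFA.mem_accepts_iff h1 rfl ?_ ?_ h2 h3 h4 ?_ h5 rfl]
  · refine and_congr_right fun h => and_congr_right fun _ => ?_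
    rw [← Nat.cast_inj (R := ℤ), Y_eq, valVec_of_noThreeOnes h]
    rfl
  · intro v z a b
    simp only [pushDigit, yLin, Prod.mk_sub_mk, Prod.fst_sub, Prod.snd_sub, Prod.mk.injEq]
    refine ⟨by ring, by ring, by ring⟩
  · intro s
    simp [yaut, yAccept]
  · intro s hs
    simp only [List.mem_cons, List.not_mem_nil, or_false] at hs
    rcases hs with rfl | rfl | rfl
    -- For Y the output may be two digits longer; state 2 is reached by the extra prefix 10.
    exacts [⟨[], 0, rfl, rfl⟩, ⟨[(0, 1)], 1, rfl, rfl⟩, ⟨[(0, 1), (0, 0)], 2, rfl, rfl⟩]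

/-! ### Synchronization and good triples -/

theorem parallelRep_fst (N x : ℕ) : NoThreeOnes ((parallelRep N x).map Prod.fst) ∧
    tribVal ((parallelRep N x).map Prod.fst) = N := by
  rw [parallelRep, List.map_fst_zip (by simp), List.leftpad, noThreeOnes_replicate_append,
    tribVal_replicate_append]
  exact ⟨(tribRep_spec N).2.1, (tribRep_spec N).1⟩

theorem parallelRep_snd (N x : ℕ) : NoThreeOnes ((parallelRep N x).map Prod.snd) ∧
    tribVal ((parallelRep N x).map Prod.snd) = x := by
  rw [parallelRep, List.map_snd_zip (by simp), List.leftpad, noThreeOnes_replicate_append,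
    tribVal_replicate_append]
  exact ⟨(tribRep_spec x).2.1, (tribRep_spec x).1⟩

theorem synchronizes_of_mem_accepts {σ : Type*} {M : DFA (Fin 2 × Fin 2) σ} {f : ℕ → ℕ}
    (h : ∀ w, w ∈ M.accepts ↔ NoThreeOnes (w.map Prod.fst) ∧ NoThreeOnes (w.map Prod.snd) ∧
      tribVal (w.map Prod.snd) = f (tribVal (w.map Prod.fst))) : Synchronizes M f := by
  intro N x
  obtain ⟨h1, h2⟩ := parallelRep_fst N x
  obtain ⟨h3, h4⟩ := parallelRep_snd N x
  rw [h, h2, h4]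
  exact ⟨fun h => h.2.2, fun h => ⟨h1, h3, h⟩⟩

theorem Synchronizes.isTribSynchronized {σ : Type*} [Fintype σ] {M : DFA (Fin 2 × Fin 2) σ}
    {f : ℕ → ℕ} (h : Synchronizes M f) : IsTribSynchronized f :=
  ⟨_, M.reindex (Fintype.equivFin σ), by intro N x; rw [DFA.accepts_reindex]; exact h N x⟩

theorem xaut_rel (n x : ℕ) : xaut.Rel n x ↔ x = X n :=
  synchronizes_of_mem_accepts mem_xaut_accepts n x

theorem yaut_rel (n y : ℕ) : yaut.Rel n y ↔ y = Y n :=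
  synchronizes_of_mem_accepts mem_yaut_accepts n y

/-- The only discrepancy is k = 0, allowed since n ≥ 1: as X(0) = Y(0) = 0, these clauses say that
x, y and y - x are nonzero, which given y > x amounts to x > 0. -/
theorem goodAut_iff {n : ℕ} (hn : 1 ≤ n) (x y : ℕ) : GoodAut n x y ↔ Good X Y n x y := by
  simp only [GoodAut, Good, xaut_rel, yaut_rel]
  have hX := X_zero
  have hY := Y_zero
  constructor
  · rintro ⟨h1, h2, h3, h4, h5, h6, h7⟩
    refine ⟨Nat.pos_of_ne_zero fun h => h2 ⟨0, hn, by rw [hX, h]⟩, h1, ?_, ?_, ?_, ?_, ?_, ?_⟩ <;>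
      intro k _ hkn h
    exacts [h2 ⟨k, hkn, h⟩, h3 ⟨k, hkn, h⟩, h4 ⟨k, hkn, h⟩, h5 ⟨k, hkn, h⟩,
      h6 ⟨k, _, _, hkn, rfl, rfl, h⟩, h7 ⟨k, _, _, hkn, rfl, rfl, h⟩]
  · rintro ⟨h0, h1, h2, h3, h4, h5, h6, h7⟩
    refine ⟨h1, ?_, ?_, ?_, ?_, ?_, ?_⟩
    · rintro ⟨k, hk, h⟩
      rcases Nat.eq_zero_or_pos k with rfl | hk0
      exacts [by omega, h2 k hk0 hk h]
    · rintro ⟨k, hk, h⟩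
      rcases Nat.eq_zero_or_pos k with rfl | hk0
      exacts [by omega, h3 k hk0 hk h]
    · rintro ⟨k, hk, h⟩
      rcases Nat.eq_zero_or_pos k with rfl | hk0
      exacts [by omega, h4 k hk0 hk h]
    · rintro ⟨k, hk, h⟩
      rcases Nat.eq_zero_or_pos k with rfl | hk0
      exacts [by omega, h5 k hk0 hk h]
    · rintro ⟨k, _, _, hk, rfl, rfl, h⟩
      rcases Nat.eq_zero_or_pos k with rfl | hk0
      exacts [by omega, h6 k hk0 hk h]
    · rintro ⟨k, _, _, hk, rfl, rfl, h⟩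
      rcases Nat.eq_zero_or_pos k with rfl | hk0
      exacts [by omega, h7 k hk0 hk h]

/-! ### Extremal properties of the greedy sequences -/

theorem exists_isGreedySystem :
    ∃ d, IsGreedySystem X d ∧ Y = fun n => X n + d n := by
  have h := isGreedySystem.X_Y_eq (by simp [xNat, cls_zero, xInc]) (by simp [dNat, cls_zero, dInc])
  have hX : X = xNat := funext fun n => (h n).1
  exact ⟨dNat, hX ▸ isGreedySystem, funext fun n => by rw [(h n).2, (h n).1]⟩

theorem good_X_Y {n : ℕ} (hn : 1 ≤ n) : Good X Y n (X n) (Y n) := by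
  obtain ⟨d, h, hY⟩ := exists_isGreedySystem
  rw [hY]
  exact h.good hn

theorem X_le_of_good {n x y : ℕ} (hg : Good X Y n x y) : X n ≤ x := by
  obtain ⟨d, h, hY⟩ := exists_isGreedySystem
  rw [hY] at hg
  exact h.le_left hg

theorem Y_le_of_good {n y : ℕ} (hg : Good X Y n (X n) y) : Y n ≤ y := by
  obtain ⟨d, h, hY⟩ := exists_isGreedySystem
  rw [hY] at hg ⊢
  exact h.le_right hg

end TribGame

theorem mainTheorem1 :
    -- the two automata synchronize the two sequences
    (TribGame.Synchronizes TribGame.xaut.toDFA TribGame.X ∧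
      TribGame.Synchronizes TribGame.yaut.toDFA TribGame.Y) ∧
    (TribGame.IsTribSynchronized TribGame.X ∧ TribGame.IsTribSynchronized TribGame.Y) ∧
    -- the exact languages, including all words with leading zeros
    (∀ w : List (Fin 2 × Fin 2), w ∈ TribGame.xaut.toDFA.accepts ↔
      TribGame.NoThreeOnes (w.map Prod.fst) ∧ TribGame.NoThreeOnes (w.map Prod.snd) ∧
        TribGame.tribVal (w.map Prod.snd) = TribGame.X (TribGame.tribVal (w.map Prod.fst))) ∧
    (∀ w : List (Fin 2 × Fin 2), w ∈ TribGame.yaut.toDFA.accepts ↔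
      TribGame.NoThreeOnes (w.map Prod.fst) ∧ TribGame.NoThreeOnes (w.map Prod.snd) ∧
        TribGame.tribVal (w.map Prod.snd) = TribGame.Y (TribGame.tribVal (w.map Prod.fst))) ∧
    -- the three conditions on good triples
    (∀ n, 1 ≤ n → TribGame.Good TribGame.X TribGame.Y n (TribGame.X n) (TribGame.Y n)) ∧
    (∀ n x y, 1 ≤ n → TribGame.Good TribGame.X TribGame.Y n x y → TribGame.X n ≤ x) ∧
    (∀ n y, 1 ≤ n → TribGame.Good TribGame.X TribGame.Y n (TribGame.X n) y →
      TribGame.Y n ≤ y) ∧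
    -- the three checks, in terms of the automata
    (∀ n x y, 1 ≤ n ∧ TribGame.xaut.Rel n x ∧ TribGame.yaut.Rel n y →
      TribGame.GoodAut n x y) ∧
    (∀ n x y, 1 ≤ n ∧ TribGame.GoodAut n x y → ∃ z, TribGame.xaut.Rel n z ∧ z ≤ x) ∧
    (∀ n x y, 1 ≤ n ∧ TribGame.xaut.Rel n x ∧ TribGame.GoodAut n x y →
      ∃ z, TribGame.yaut.Rel n z ∧ z ≤ y) := by
  have hx := TribGame.synchronizes_of_mem_accepts TribGame.mem_xaut_accepts
  have hy := TribGame.synchronizes_of_mem_accepts TribGame.mem_yaut_accepts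
  refine ⟨⟨hx, hy⟩, ⟨hx.isTribSynchronized, hy.isTribSynchronized⟩, TribGame.mem_xaut_accepts,
    TribGame.mem_yaut_accepts, fun n hn => TribGame.good_X_Y hn,
    fun n x y _ => TribGame.X_le_of_good, fun n y _ => TribGame.Y_le_of_good, ?_, ?_, ?_⟩
  · rintro n x y ⟨hn, h1, h2⟩
    rw [TribGame.xaut_rel] at h1
    rw [TribGame.yaut_rel] at h2
    rw [TribGame.goodAut_iff hn, h1, h2]
    exact TribGame.good_X_Y hn
  · rintro n x y ⟨hn, h⟩
    exact ⟨_, (TribGame.xaut_rel n _).2 rfl,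
      TribGame.X_le_of_good ((TribGame.goodAut_iff hn x y).1 h)⟩
  · rintro n x y ⟨hn, h1, h⟩
    rw [TribGame.xaut_rel] at h1
    rw [TribGame.goodAut_iff hn, h1] at h
    exact ⟨_, (TribGame.yaut_rel n _).2 rfl, TribGame.Y_le_of_good h⟩
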